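/- **Conventions.** A tensor-triangulated category is a triangulated category with a closed symmetric monoidal structure $(\otimes,\mathbb 1,\underline{\hom})$ compatible with the triangulation in the sense of Hovey–Palmieri–Strickland. It is *rigidly-compactly generated* if it has all small coproducts, has a set $\mathcal G$ of compact objects such that $\mathrm{Hom}(\mathcal G,t)=0$ implies $t=0$, and its compact objects (those $t$ for which $\mathrm{Hom}(t,-)$ preserves coproducts) are exactly its rigid objects (those $x$ for which $\underline{\hom}(x,\mathbb 1)\otimes y\to\underline{\hom}(x,y)$ is an isomorphism for all $y$). We write $\mathcal T^c$ for the subcategory of compact objects of $\mathcal T$. A *$\mathcal T^c$-submodule* is a thick triangulated subcategory $\mathcal T_0\subset\mathcal T$ with $c\otimes x\in\mathcal T_0$ for $c\in\mathcal T^c$, $x\in\mathcal T_0$. An object $\kappa\in\mathcal T_0$ is a *dualizing object* for the $\mathcal T^c$-submodule $\mathcal T_0$ if $\Delta_\kappa:=\underline{\hom}(-,\kappa)$ restricts to an equivalence $\mathcal T_0^{\mathrm{op}}\simeq\mathcal T_0$. A functor $F$ between categories with dualities $\Delta$ and $\Delta'$ and biduality maps $\varpi\colon x\to\Delta\Delta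 x$, $\varpi'\colon y\to\Delta'\Delta' y$ is *duality-preserving* if it is equipped with a natural isomorphism $\zeta\colon F\Delta\cong\Delta'F$ with $\zeta_{\Delta x}\circ F(\varpi_x)=\Delta'(\zeta_x)\circ\varpi'_{Fx}$ for all $x$. **Statement.** Let $\mathcal B,\mathcal C,\mathcal D$ be rigidly-compactly generated tensor-triangulated categories, let $p^*\colon\mathcal B\to\mathcal C$, $q^*\colon\mathcal B\to\mathcal D$ and $f^*\colon\mathcal D\to\mathcal C$ be exact strong symmetric monoidal functors preserving small coproducts, and let $f^*q^*\cong p^*$ be a natural isomorphism. Then each $h^*\in\{p^*,q^*,f^*\}$ admits a right adjoint $h_*$, which itself admits a right adjoint $h^{(1)}$. Put $\omega_p=p^{(1)}(\mathbb 1)$, $\omega_q=q^{(1)}(\mathbb 1)$. For a functor $h_*\colon\mathcal S\to\mathcal T$ as above and a full subcategory $\mathcal T_0\subset\mathcal T$ put $$h^\#(\mathcal T_0)=\{x\in\mathcal S\mid h_*(c\otimes x)\in\mathcal T_0\text{ for all }c\in\mathcal S^c\},$$ and $\mathcal C^{c/p}=p^\#(\mathcal B^c)$, $\mathcal D^{c/q}=q^\#(\mathcal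 B^c)$. Say that $h^*$ *satisfies Grothendieck–Neeman duality* if $h_*$ preserves compact objects. 1. Suppose that $p^*$ and $q^*$ satisfy Grothendieck–Neeman duality. Let $\mathcal B_0\subset\mathcal B$ be a $\mathcal B^c$-submodule with dualizing object $\kappa\in\mathcal B_0$, and put $\mathcal C_0=p^\#(\mathcal B_0)$, $\mathcal D_0=q^\#(\mathcal B_0)$, $\gamma=\omega_p\otimes p^*(\kappa)$, $\delta=\omega_q\otimes q^*(\kappa)$. Then $f^\#(\mathcal D_0)=\mathcal C_0$; the subcategory $\mathcal C_0$ is a $\mathcal C^c$-submodule with dualizing object $\gamma$, and $\mathcal D_0$ is a $\mathcal D^c$-submodule with dualizing object $\delta$; and $f_*$ restricts to an exact functor $\mathcal C_0\to\mathcal D_0$ which is duality-preserving with respect to $\Delta_\gamma$ and $\Delta_\delta$. More precisely, there is an isomorphism $\gamma\cong f^{(1)}(\delta)$, and for every such isomorphism the canonical maps $f_*\underline{\hom}(x,\gamma)\to\underline{\hom}(f_*x,\delta)$, adjoint to $f_*x\otimes f_*\underline{\hom}(x,\gamma)\to f_*(x\otimes\underline{\hom}(x,\gamma))\to f_*\gamma\cong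 f_*f^{(1)}\delta\to\delta$, form such a duality-preserving structure. 2. Without assuming Grothendieck–Neeman duality, $f^\#(\mathcal D^{c/q})=\mathcal C^{c/p}$. 3. If $p^*$ satisfies Grothendieck–Neeman duality, then $\mathcal C^{c/p}$ is a $\mathcal C^c$-submodule with dualizing object $\omega_p$. 4. If $p^*$ and $q^*$ satisfy Grothendieck–Neeman duality, then $f_*$ restricts to an exact functor $\mathcal C^{c/p}\to\mathcal D^{c/q}$ which is duality-preserving (in the same precise sense, for isomorphisms $\omega_p\cong f^{(1)}(\omega_q)$) with respect to $\Delta_{\omega_p}$ and $\Delta_{\omega_q}$. -/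

import Mathlib

open CategoryTheory Category Limits MonoidalCategory Pretriangulated Opposite

universe v u₁ u₂ u₃

noncomputable section

namespace TensorTriangular

section MonoidalNotions

variable {C : Type u₁} [Category.{v} C] [MonoidalCategory C] [SymmetricCategory C]
  [MonoidalClosed C]

/-- The natural map `[x, 𝟙] ⊗ y ⟶ [x, y]`, adjoint to evaluation
`x ⊗ ([x, 𝟙] ⊗ y) ⟶ 𝟙 ⊗ y ≅ y`. -/
def rigidityMap (x y : C) : (ihom x).obj (𝟙_ C) ⊗ y ⟶ (ihom x).obj y :=
  MonoidalClosed.curry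
    ((α_ x ((ihom x).obj (𝟙_ C)) y).inv ≫ (ihom.ev x).app (𝟙_ C) ▷ y ≫ (λ_ y).hom)

/-- `x` is rigid if `[x, 𝟙] ⊗ y ⟶ [x, y]` is an isomorphism for every `y`. -/
def IsRigid (x : C) : Prop := ∀ y : C, IsIso (rigidityMap x y)

/-- The `κ`-twisted dual `Δ_κ = [-, κ]`. -/
abbrev twistedDual (κ : C) : Cᵒᵖ ⥤ C := MonoidalClosed.internalHom.flip.obj κ

/-- The canonical map `ϖ_κ : x ⟶ Δ_κ (Δ_κ x) = [[x, κ], κ]`, adjoint to evaluation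
`[x, κ] ⊗ x ⟶ κ`. -/
def biduality (κ x : C) : x ⟶ (ihom ((ihom x).obj κ)).obj κ :=
  MonoidalClosed.curry ((β_ ((ihom x).obj κ) x).hom ≫ (ihom.ev x).app κ)

lemma biduality_natural (κ : C) {x y : C} (g : x ⟶ y) :
    g ≫ biduality κ y =
      biduality κ x ≫ (MonoidalClosed.pre ((MonoidalClosed.pre g).app κ)).app κ := by
  apply MonoidalClosed.uncurry_injective
  rw [biduality, biduality, MonoidalClosed.uncurry_natural_left, MonoidalClosed.uncurry_curry,
    MonoidalClosed.uncurry_eq, MonoidalCategory.whiskerLeft_comp, Category.assoc,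
    MonoidalClosed.id_tensor_pre_app_comp_ev, whisker_exchange_assoc,
    ← MonoidalClosed.uncurry_eq, MonoidalClosed.uncurry_curry,
    BraidedCategory.braiding_naturality_left_assoc,
    BraidedCategory.braiding_naturality_right_assoc,
    MonoidalClosed.id_tensor_pre_app_comp_ev]

lemma biduality_dual (κ x : C) :
    biduality κ ((ihom x).obj κ) ≫ (MonoidalClosed.pre (biduality κ x)).app κ =
      𝟙 ((ihom x).obj κ) := by
  apply MonoidalClosed.uncurry_injective
  rw [MonoidalClosed.uncurry_eq, MonoidalCategory.whiskerLeft_comp, Category.assoc,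
    MonoidalClosed.id_tensor_pre_app_comp_ev, whisker_exchange_assoc,
    ← MonoidalClosed.uncurry_eq, biduality, biduality, MonoidalClosed.uncurry_curry,
    BraidedCategory.braiding_naturality_left_assoc, ← MonoidalClosed.uncurry_eq,
    MonoidalClosed.uncurry_curry, SymmetricCategory.symmetry_assoc,
    MonoidalClosed.uncurry_id_eq_ev]

end MonoidalNotions

section CategoriesWithDuality

/-- A category with (weak) duality: a contravariant endofunctor with a natural transformation
`ϖ` from the identity to its square such that `Δ(ϖ_x) ∘ ϖ_{Δ x} = id`. -/
structure Duality (A : Type u₁) [Category.{v} A] where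
  dual : Aᵒᵖ ⥤ A
  bidual : 𝟭 A ⟶ dual.rightOp ⋙ dual
  bidual_dual : ∀ x : A,
    bidual.app (dual.obj (op x)) ≫ dual.map (bidual.app x).op = 𝟙 (dual.obj (op x))

/-- A duality-preserving functor `(F, ζ)`: a natural isomorphism `ζ : F ∘ Δ ≅ Δ ∘ F`
compatible with the biduality maps. -/
structure DualityPreserving {A : Type u₁} [Category.{v} A] {B : Type u₂} [Category.{v} B]
    (𝒜 : Duality A) (ℬ : Duality B) (F : A ⥤ B) where
  ζ : 𝒜.dual ⋙ F ≅ F.op ⋙ ℬ.dual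
  bidual_comp : ∀ x : A,
    F.map (𝒜.bidual.app x) ≫ ζ.hom.app (op (𝒜.dual.obj (op x))) =
      ℬ.bidual.app (F.obj x) ≫ ℬ.dual.map (ζ.hom.app (op x)).op

/-- A duality restricts to any full subcategory stable under it. -/
def Duality.restrict {A : Type u₁} [Category.{v} A] (𝒜 : Duality A) (P : ObjectProperty A)
    (h : ∀ x, P x → P (𝒜.dual.obj (op x))) : Duality P.FullSubcategory where
  dual := P.lift (P.ι.op ⋙ 𝒜.dual) (fun x => h _ x.unop.property)
  bidual :=
    { app := fun x => P.homMk (𝒜.bidual.app x.obj)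
      naturality := fun x y g => by
        ext
        exact 𝒜.bidual.naturality g.hom }
  bidual_dual := fun x => by
    ext
    exact 𝒜.bidual_dual x.obj

/-- The duality `Δ_κ = [-, κ]` on a closed symmetric monoidal category. -/
def twistedDuality {C : Type u₁} [Category.{v} C] [MonoidalCategory C] [SymmetricCategory C]
    [MonoidalClosed C] (κ : C) : Duality C where
  dual := twistedDual κ
  bidual :=
    { app := fun x => biduality κ x
      naturality := fun _ _ g => biduality_natural κ g }
  bidual_dual := fun x => biduality_dual κ x

end CategoriesWithDuality

section Triangulated

variable (C : Type u₁) [Category.{v} C] [Preadditive C] [HasZeroObject C] [HasShift C ℤ]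
  [∀ n : ℤ, (shiftFunctor C n).Additive] [Pretriangulated C]

/-- `t` is compact if `Hom(t, -)`, with values in abelian groups, preserves coproducts. -/
def compactObjects : ObjectProperty C := fun t =>
  ∀ J : Type v, PreservesColimitsOfShape (Discrete J) (preadditiveCoyoneda.obj (op t))

/-- `C` has all (small) coproducts and a set `𝒢` of compact objects such that
`Hom(𝒢, t) = 0` implies `t = 0`. -/
structure IsCompactlyGeneratedCategory : Prop where
  hasCoproducts : HasCoproducts.{v} C
  exists_generators : ∃ 𝒢 : ObjectProperty C, ObjectProperty.Small.{v} 𝒢 ∧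
    𝒢 ≤ compactObjects C ∧
    ∀ t : C, (∀ g, 𝒢 g → ∀ φ : g ⟶ t, φ = 0) → IsZero t

variable [MonoidalCategory C] [SymmetricCategory C] [MonoidalClosed C]

/-- Compatibility (in the sense of Hovey, Palmieri and Strickland) of a closed symmetric monoidal
structure with a triangulation. Exactness of `[W, -]` is not listed, because the right adjoint
of an exact functor is exact. -/
class TensorTriangulated where
  /-- the tensor product commutes with the suspension -/
  e : ∀ x y : C, x⟦(1 : ℤ)⟧ ⊗ y ≅ (x ⊗ y)⟦(1 : ℤ)⟧
  e_natural_left : ∀ {x x' : C} (g : x ⟶ x') (y : C),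
    g⟦(1 : ℤ)⟧' ▷ y ≫ (e x' y).hom = (e x y).hom ≫ (g ▷ y)⟦(1 : ℤ)⟧'
  e_natural_right : ∀ (x : C) {y y' : C} (g : y ⟶ y'),
    x⟦(1 : ℤ)⟧ ◁ g ≫ (e x y').hom = (e x y).hom ≫ (x ◁ g)⟦(1 : ℤ)⟧'
  e_unit : ∀ x : C,
    (e x (𝟙_ C)).hom ≫ (ρ_ x).hom⟦(1 : ℤ)⟧' = (ρ_ (x⟦(1 : ℤ)⟧)).hom
  e_assoc : ∀ x y z : C,
    (e x y).hom ▷ z ≫ (e (x ⊗ y) z).hom ≫ (α_ x y z).hom⟦(1 : ℤ)⟧' =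
      (α_ (x⟦(1 : ℤ)⟧) y z).hom ≫ (e x (y ⊗ z)).hom
  /-- `- ⊗ w` is exact -/
  tensor_exact : ∀ (T : Triangle C), T ∈ distTriang C → ∀ w : C,
    Triangle.mk (T.mor₁ ▷ w) (T.mor₂ ▷ w) (T.mor₃ ▷ w ≫ (e T.obj₁ w).hom) ∈ distTriang C
  /-- `[-, w]` sends an exact triangle `(f, g, h)` on `x, y, z` to the exact triangle
  `[z, w] ⟶ [y, w] ⟶ [x, w] ⟶ [z, w]⟦1⟧`, whose last map `d` is `[h, w]⟦1⟧` up to the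
  canonical isomorphism `[x⟦1⟧, w]⟦1⟧ ≅ [x, w]`. The latter is adjoint to
  `x ⊗ [x⟦1⟧, w]⟦1⟧ ≅ (x ⊗ [x⟦1⟧, w])⟦1⟧ ≅ x⟦1⟧ ⊗ [x⟦1⟧, w] ⟶ w`. -/
  ihom_exact : ∀ (T : Triangle C), T ∈ distTriang C → ∀ w : C,
    ∃ d : (ihom T.obj₁).obj w ⟶ ((ihom T.obj₃).obj w)⟦(1 : ℤ)⟧,
      MonoidalClosed.curry
          ((β_ T.obj₁ (((ihom (T.obj₁⟦(1 : ℤ)⟧)).obj w)⟦(1 : ℤ)⟧)).hom ≫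
            (e ((ihom (T.obj₁⟦(1 : ℤ)⟧)).obj w) T.obj₁).hom ≫
            (β_ ((ihom (T.obj₁⟦(1 : ℤ)⟧)).obj w) T.obj₁).hom⟦(1 : ℤ)⟧' ≫
            (e T.obj₁ ((ihom (T.obj₁⟦(1 : ℤ)⟧)).obj w)).inv ≫
            (ihom.ev (T.obj₁⟦(1 : ℤ)⟧)).app w) ≫ d =
        ((MonoidalClosed.pre T.mor₃).app w)⟦(1 : ℤ)⟧' ∧
      Triangle.mk ((MonoidalClosed.pre T.mor₂).app w) ((MonoidalClosed.pre T.mor₁).app w) d ∈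
        distTriang C
  /-- graded commutativity: the symmetry of `𝟙⟦1⟧ ⊗ 𝟙⟦1⟧` is `-1` (by coherence, the symmetry of
  `𝟙⟦r⟧ ⊗ 𝟙⟦s⟧` is then `(-1)^(r * s)` for all integers `r` and `s`) -/
  braiding_unit_shift :
    (β_ ((𝟙_ C)⟦(1 : ℤ)⟧) ((𝟙_ C)⟦(1 : ℤ)⟧)).hom = -𝟙 ((𝟙_ C)⟦(1 : ℤ)⟧ ⊗ (𝟙_ C)⟦(1 : ℤ)⟧)

/-- Compactly generated, and the compact objects are exactly the rigid ones. -/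
structure IsRigidlyCompactlyGenerated : Prop extends IsCompactlyGeneratedCategory C where
  compact_iff_rigid : ∀ x : C, compactObjects C x ↔ IsRigid x

variable {C}

/-- A `C^c`-submodule: a thick triangulated subcategory (full, replete, closed under suspension,
cones and direct summands) stable under tensoring with compact objects. -/
structure IsCompactSubmodule (C₀ : ObjectProperty C) : Prop where
  isTriangulated : C₀.IsTriangulated
  isStableUnderRetracts : C₀.IsStableUnderRetracts
  tensor_mem : ∀ c x : C, compactObjects C c → C₀ x → C₀ (c ⊗ x)

/-- `κ` is a dualizing object for the `C^c`-submodule `C₀`: it lies in `C₀`, and `Δ_κ = [-, κ]`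
restricts to an anti-equivalence `C₀ᵒᵖ ≌ C₀`. -/
structure IsDualizingObject (C₀ : ObjectProperty C) (κ : C) : Prop where
  isCompactSubmodule : IsCompactSubmodule C₀
  mem : C₀ κ
  dual_mem : ∀ x, C₀ x → C₀ ((twistedDual κ).obj (op x))
  isEquivalence : (C₀.lift (C₀.ι.op ⋙ twistedDual κ)
    (fun x => dual_mem _ x.unop.property) : C₀.FullSubcategoryᵒᵖ ⥤ _).IsEquivalence

/-- The category with duality `(C₀, Δ_κ)`. -/
def IsDualizingObject.duality {C₀ : ObjectProperty C} {κ : C} (h : IsDualizingObject C₀ κ) :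
    Duality C₀.FullSubcategory :=
  (twistedDuality κ).restrict C₀ h.dual_mem

end Triangulated

section Functors

/-- `F` preserves arbitrary (small) coproducts. -/
def PreservesCoproducts {C : Type u₁} [Category.{v} C] {D : Type u₂} [Category.{v} D]
    (F : D ⥤ C) : Prop :=
  ∀ J : Type v, PreservesColimitsOfShape (Discrete J) F

/-- A choice of adjoints `f^* ⊣ f_* ⊣ f^(1)` of a functor `f^*`. -/
structure AdjointTriple {C : Type u₁} [Category.{v} C] {D : Type u₂} [Category.{v} D]
    (f : D ⥤ C) where
  /-- the right adjoint `f_*` of `f^*` -/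
  push : C ⥤ D
  /-- the right adjoint `f^(1)` of `f_*` -/
  twist : D ⥤ C
  adj₁ : f ⊣ push
  adj₂ : push ⊣ twist

/-- The relative dualizing object `ω_f = f^(1)(𝟙)`. -/
def AdjointTriple.ω {C : Type u₁} [Category.{v} C] {D : Type u₂} [Category.{v} D]
    [MonoidalCategory D] {f : D ⥤ C} (A : AdjointTriple f) : C :=
  A.twist.obj (𝟙_ D)

/-- Grothendieck–Neeman duality for `f^*`, in the form of Neeman's criterion: the right
adjoint `f_*` of `f^*` preserves compact objects. -/
def SatisfiesGrothendieckNeeman {C : Type u₁} [Category.{v} C] [Preadditive C]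
    {D : Type u₂} [Category.{v} D] [Preadditive D] (f : D ⥤ C) : Prop :=
  ∃ (g : C ⥤ D) (_ : f ⊣ g), ∀ c : C, compactObjects C c → compactObjects D (g.obj c)

/-- The compact pull-back `{x | f_*(c ⊗ x) ∈ D₀ for all compact c}` along `g = f_*`. -/
def compactPullback {C : Type u₁} [Category.{v} C] [Preadditive C] [MonoidalCategory C]
    {D : Type u₂} [Category.{v} D] (g : C ⥤ D) (D₀ : ObjectProperty D) : ObjectProperty C :=
  fun x => ∀ c : C, compactObjects C c → D₀ (g.obj (c ⊗ x))

section Comparison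

variable {C : Type u₁} [Category.{v} C] [MonoidalCategory C] [SymmetricCategory C]
  [MonoidalClosed C] {D : Type u₂} [Category.{v} D] [MonoidalCategory D] [SymmetricCategory D]
  [MonoidalClosed D] {f : D ⥤ C} [f.Braided]

/-- Given `ψ : γ ⟶ f^(1) δ`, the canonical map `f_* [x, γ] ⟶ [f_* x, δ]`, adjoint to
`f_* x ⊗ f_* [x, γ] ⟶ f_* (x ⊗ [x, γ]) ⟶ f_* γ ⟶ δ`. The first map is the lax monoidal
structure of `f_*`, and the last one is adjoint to `ψ`. -/
def AdjointTriple.dualComparison (A : AdjointTriple f) {γ : C} {δ : D}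
    (ψ : γ ⟶ A.twist.obj δ) (x : C) :
    A.push.obj ((twistedDual γ).obj (op x)) ⟶ (twistedDual δ).obj (op (A.push.obj x)) :=
  letI := A.adj₁.rightAdjointLaxMonoidal
  MonoidalClosed.curry
    (Functor.LaxMonoidal.μ A.push x ((ihom x).obj γ) ≫
      A.push.map ((ihom.ev x).app γ) ≫ (A.adj₂.homEquiv γ δ).symm ψ)

end Comparison

section Restriction

variable {C : Type u₁} [Category.{v} C] [Preadditive C] [HasZeroObject C] [HasShift C ℤ]
  [∀ n : ℤ, (shiftFunctor C n).Additive] [Pretriangulated C]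
  [MonoidalCategory C] [SymmetricCategory C] [MonoidalClosed C]
  {D : Type u₂} [Category.{v} D] [Preadditive D] [HasZeroObject D] [HasShift D ℤ]
  [∀ n : ℤ, (shiftFunctor D n).Additive] [Pretriangulated D]
  [MonoidalCategory D] [SymmetricCategory D] [MonoidalClosed D]
  {f : D ⥤ C} [f.Braided] [f.CommShift ℤ]

/-- The functor `C₀ ⥤ D₀` obtained by restricting `f_*`. -/
abbrev AdjointTriple.restrictPush (A : AdjointTriple f) (C₀ : ObjectProperty C)
    (D₀ : ObjectProperty D) (h : ∀ x, C₀ x → D₀ (A.push.obj x)) :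
    C₀.FullSubcategory ⥤ D₀.FullSubcategory :=
  D₀.lift (C₀.ι ⋙ A.push) (fun x => h _ x.property)

/-- `f_*` restricts to a functor `C₀ ⥤ D₀` which is exact (for the commutation with suspensions
inherited from `f^*` by adjunction) and duality-preserving for `Δ_γ` and `Δ_δ`. More precisely,
`γ ≅ f^(1) δ`, and for every such isomorphism the canonical maps `f_* [x, γ] ⟶ [f_* x, δ]`
are the components of a duality-preserving structure. -/
def AdjointTriple.RestrictsToDualityPreserving (A : AdjointTriple f)
    {C₀ : ObjectProperty C} {D₀ : ObjectProperty D} {γ : C} {δ : D}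
    (hγ : IsDualizingObject C₀ γ) (hδ : IsDualizingObject D₀ δ) : Prop :=
  ∃ h : ∀ x, C₀ x → D₀ (A.push.obj x),
    (letI := A.adj₁.rightAdjointCommShift ℤ
     haveI := hγ.isCompactSubmodule.isTriangulated
     haveI := hδ.isCompactSubmodule.isTriangulated
     (A.restrictPush C₀ D₀ h).IsTriangulated) ∧
    Nonempty (γ ≅ A.twist.obj δ) ∧
    ∀ ψ : γ ≅ A.twist.obj δ,
      ∃ S : DualityPreserving hγ.duality hδ.duality (A.restrictPush C₀ D₀ h),
        ∀ x : C₀.FullSubcategory,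
          (S.ζ.hom.app (op x)).hom = A.dualComparison ψ.hom x.obj

end Restriction

end Functors

end TensorTriangular

end

open TensorTriangular

set_option linter.unusedSectionVars false
open TensorTriangular

/-! Everything is formal once three facts are known for h^* ⊣ h_* ⊣ h^(1): the projection formula
h_*x ⊗ b ≅ h_*(x ⊗ h^*b); the duality isomorphism h_*[x, γ] ≅ [h_*x, δ] for γ ≅ h^(1)δ
(`isIso_ihomComparison`), which follows from it by Yoneda and is compatible with biduality
(`map_biduality_ihomComparison`); and h^(1)(𝟙) ⊗ h^*b ≅ h^(1)b (`nonempty_twist_iso`). Only the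
third needs h_* to preserve compact objects.

The adjoints exist by Brown representability (`exists_universal`), applied to h^* and then to h_*.
The latter preserves coproducts because h^* preserves rigid, that is, compact objects. The first and
third isomorphisms are formal for dualizable b. They extend to all b because, tested against a
compact object, both sides are homological and coproduct-preserving in b (`isIso_app`).

Put γ ≅ p^(1)κ. For a dual pair (c, d) of compact objects, p_*(c ⊗ [x, γ]) ≅ [p_*(x ⊗ d), κ], so the
compact pull-back of B₀ is stable under Δ_γ. It contains γ because p_* preserves compact objects.
The functor p_* inverts the biduality map of x, but it need not be conservative. It does detect
bijectivity on maps out of 𝟙 ≅ p^*𝟙, and maps c ⟶ x are maps 𝟙 ⟶ x ⊗ d, so applying this to every x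
⊗ d suffices (`isDualizingObject_compactPullback`).

Finally p_* ≅ q_* f_* yields p^(1) ≅ f^(1) q^(1), so γ ≅ f^(1)δ, and the duality isomorphism for f^*
is the duality-preserving structure; f_* itself need not preserve compact objects. -/

namespace TensorTriangular

/-! ### Compactness as finite factorization of maps into coproducts. -/

section Coproducts

variable {C : Type u₁} [Category.{v} C] [Preadditive C]

/-- The idempotent of a coproduct which projects onto the summands indexed by a finite set. -/
noncomputable def finiteProjection [HasCoproducts.{v} C] {J : Type v} (x : J → C) (S : Finset J) :
    ∐ x ⟶ ∐ x := by
  classical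
  exact Sigma.desc fun j => if j ∈ S then Sigma.ι x j else 0

open Classical in
lemma ι_finiteProjection [HasCoproducts.{v} C] {J : Type v} (x : J → C) (S : Finset J) (j : J) :
    Sigma.ι x j ≫ finiteProjection x S = if j ∈ S then Sigma.ι x j else 0 := by
  simp [finiteProjection]

open scoped Classical in
lemma ι_finiteProjection_assoc [HasCoproducts.{v} C] {J : Type v} (x : J → C) (S : Finset J)
    (j : J) {y : C} (k : ∐ x ⟶ y) : Sigma.ι x j ≫ finiteProjection x S ≫ k =
      (if j ∈ S then Sigma.ι x j else 0) ≫ k := by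
  rw [← assoc, ι_finiteProjection]

/-- The projection of a coproduct onto a summand. -/
noncomputable def coproductProjection [HasCoproducts.{v} C] {J : Type v} (x : J → C) (j : J) :
    ∐ x ⟶ x j := by
  classical
  exact Sigma.desc fun i => if h : i = j then eqToHom (by rw [h]) else 0

@[simp]
lemma ι_coproductProjection_self [HasCoproducts.{v} C] {J : Type v} (x : J → C) (j : J) :
    Sigma.ι x j ≫ coproductProjection x j = 𝟙 _ := by
  simp [coproductProjection]

@[simp]
lemma ι_coproductProjection_self_assoc [HasCoproducts.{v} C] {J : Type v} (x : J → C) (j : J)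
    {y : C} (k : x j ⟶ y) : Sigma.ι x j ≫ coproductProjection x j ≫ k = k := by
  rw [← assoc, ι_coproductProjection_self, id_comp]

lemma ι_coproductProjection_of_ne [HasCoproducts.{v} C] {J : Type v} (x : J → C) {i j : J}
    (h : i ≠ j) : Sigma.ι x i ≫ coproductProjection x j = 0 := by
  simp [coproductProjection, h]

lemma ι_coproductProjection_of_ne_assoc [HasCoproducts.{v} C] {J : Type v} (x : J → C) {i j : J}
    (h : i ≠ j) {y : C} (k : x j ⟶ y) :
    Sigma.ι x i ≫ coproductProjection x j ≫ k = (0 : x i ⟶ x j) ≫ k := by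
  rw [← assoc, ι_coproductProjection_of_ne x h]

lemma finiteProjection_eq_sum [HasCoproducts.{v} C] {J : Type v} (x : J → C) (S : Finset J) :
    finiteProjection x S = ∑ j ∈ S, coproductProjection x j ≫ Sigma.ι x j := by
  classical
  ext i
  rw [ι_finiteProjection, Preadditive.comp_sum]
  split_ifs with h
  · rw [Finset.sum_eq_single i]
    · simp
    · intro j _ hj
      rw [ι_coproductProjection_of_ne_assoc x hj.symm, zero_comp]
    · exact fun h' => (h' h).elim
  · rw [Finset.sum_eq_zero]
    intro j hj
    rw [ι_coproductProjection_of_ne_assoc x (by rintro rfl; exact h hj), zero_comp]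

lemma finiteProjection_comp [HasCoproducts.{v} C] {J : Type v} [DecidableEq J] (x : J → C)
    (S S' : Finset J) :
    (𝟙 _ - finiteProjection x S) ≫ (𝟙 _ - finiteProjection x S') =
      𝟙 _ - finiteProjection x (S ∪ S') := by
  ext i
  by_cases h : i ∈ S <;> by_cases h' : i ∈ S' <;>
    simp [Preadditive.sub_comp, Preadditive.comp_sub, ι_finiteProjection, h, h',
      ι_finiteProjection_assoc]

lemma comp_finiteProjection_of_subset [HasCoproducts.{v} C] {J : Type v} {x : J → C}
    {S S' : Finset J} (h : S ⊆ S') {t : C} {φ : t ⟶ ∐ x} (hφ : φ ≫ finiteProjection x S = φ) :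
    φ ≫ finiteProjection x S' = φ := by
  classical
  have : finiteProjection x S ≫ finiteProjection x S' = finiteProjection x S := by
    ext i
    by_cases hi : i ∈ S
    · simp [ι_finiteProjection, ι_finiteProjection_assoc, hi, h hi]
    · simp [ι_finiteProjection_assoc, ι_finiteProjection, hi]
  rw [← hφ, assoc, this]

/-- Every morphism from `t` to a coproduct factors through a finite subcoproduct. -/
def FactorsFinitely [HasCoproducts.{v} C] (t : C) : Prop :=
  ∀ ⦃J : Type v⦄ (x : J → C) (φ : t ⟶ ∐ x), ∃ S : Finset J, φ ≫ finiteProjection x S = φ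

/-- The finitely supported maps form a subgroup R of Hom(t, ∐ x) containing every map into a single
summand. Since Hom(t, -) preserves the coproduct, the quotient map by R is determined on the
summands, so it vanishes. -/
lemma compactObjects.factorsFinitely [HasCoproducts.{v} C] {t : C} (ht : compactObjects C t) :
    FactorsFinitely t := by
  classical
  intro J x φ
  have := ht J
  let R : AddSubgroup (t ⟶ ∐ x) :=
    { carrier := {φ | ∃ S : Finset J, φ ≫ finiteProjection x S = φ}
      zero_mem' := ⟨∅, by simp⟩
      add_mem' := by
        rintro a b ⟨S, hS⟩ ⟨S', hS'⟩
        refine ⟨S ∪ S', ?_⟩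
        rw [Preadditive.add_comp,
          comp_finiteProjection_of_subset Finset.subset_union_left hS,
          comp_finiteProjection_of_subset Finset.subset_union_right hS']
      neg_mem' := by
        rintro a ⟨S, hS⟩
        exact ⟨S, by rw [Preadditive.neg_comp, hS]⟩ }
  let G := preadditiveCoyoneda.obj (op t)
  let a : G.obj (∐ x) ⟶ AddCommGrpCat.of ((t ⟶ ∐ x) ⧸ R) :=
    AddCommGrpCat.ofHom (QuotientAddGroup.mk' R)
  have ha : a = 0 := by
    refine Cofan.IsColimit.hom_ext (isColimitOfHasCoproductOfPreservesColimit G x) _ _ ?_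
    intro j
    ext ψ
    change QuotientAddGroup.mk' R (ψ ≫ Sigma.ι x j) = 0
    rw [QuotientAddGroup.mk'_apply, QuotientAddGroup.eq_zero_iff]
    have mem (χ : t ⟶ x j) : χ ≫ Sigma.ι x j ∈ R :=
      ⟨{j}, by rw [assoc, ι_finiteProjection, if_pos (Finset.mem_singleton_self j)]⟩
    exact mem ψ
  have h : QuotientAddGroup.mk' R φ = 0 :=
    congr($(ha).hom φ)
  rw [QuotientAddGroup.mk'_apply, QuotientAddGroup.eq_zero_iff] at h
  exact h

lemma comp_coproductProjection_eq_zero [HasCoproducts.{v} C] {J : Type v} {x : J → C}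
    {S : Finset J} {t : C} {φ : t ⟶ ∐ x} (hφ : φ ≫ finiteProjection x S = φ) {j : J}
    (hj : j ∉ S) : φ ≫ coproductProjection x j = 0 := by
  rw [← hφ, finiteProjection_eq_sum, assoc, Preadditive.sum_comp, Preadditive.comp_sum]
  refine Finset.sum_eq_zero fun i hi => ?_
  rw [assoc, ι_coproductProjection_of_ne, comp_zero, comp_zero]
  rintro rfl
  exact hj hi

namespace FactorsFinitely

variable [HasCoproducts.{v} C] {t : C} (ht : FactorsFinitely t) {J : Type v} {x : J → C}
  {A : Type*} [AddCommGroup A] (h : ∀ j, (t ⟶ x j) →+ A)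

include ht in
lemma finite_support (φ : t ⟶ ∐ x) :
    (Function.support fun j => h j (φ ≫ coproductProjection x j)).Finite := by
  obtain ⟨S, hS⟩ := ht x φ
  refine S.finite_toSet.subset fun j hj => ?_
  by_contra hj'
  apply hj
  change h j _ = 0
  rw [comp_coproductProjection_eq_zero hS hj', map_zero]

/-- The homomorphism out of `Hom(t, ∐ x)` given by homomorphisms out of all `Hom(t, x j)`. -/
noncomputable def desc : (t ⟶ ∐ x) →+ A where
  toFun φ := ∑ᶠ j, h j (φ ≫ coproductProjection x j)
  map_zero' := finsum_eq_zero_of_forall_eq_zero fun j => by rw [zero_comp, map_zero]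
  map_add' φ ψ := by
    rw [← finsum_add_distrib (ht.finite_support h φ) (ht.finite_support h ψ)]
    exact finsum_congr fun j => by rw [Preadditive.add_comp, map_add]

lemma desc_ι (j : J) (ψ : t ⟶ x j) : ht.desc h (ψ ≫ Sigma.ι x j) = h j ψ := by
  change (∑ᶠ i, h i ((ψ ≫ Sigma.ι x j) ≫ coproductProjection x i)) = _
  rw [finsum_eq_single _ j]
  · simp
  · intro i hi
    rw [assoc, ι_coproductProjection_of_ne _ hi.symm, comp_zero, map_zero]

include ht in
lemma hom_ext {a b : (t ⟶ ∐ x) →+ A} (hab : ∀ j (ψ : t ⟶ x j),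
    a (ψ ≫ Sigma.ι x j) = b (ψ ≫ Sigma.ι x j)) : a = b := by
  ext φ
  obtain ⟨S, hS⟩ := ht x φ
  rw [← hS, finiteProjection_eq_sum, Preadditive.comp_sum, map_sum, map_sum]
  exact Finset.sum_congr rfl fun j _ => by rw [← assoc, hab]

-- Finite support makes the sum over all components meaningful, so `desc` supplies the universal
-- property of the coproduct of the groups Hom(t, x j).
include ht in
protected lemma compactObjects : compactObjects C t := by
  intro J
  apply +allowSynthFailures preservesColimitsOfShape_of_discrete
  intro x
  let G := preadditiveCoyoneda.obj (op t)
  refine preservesColimit_of_preserves_colimit_cocone (coproductIsCoproduct x) ?_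
  refine (isColimitMapCoconeCofanMkEquiv G x (Sigma.ι x)).symm ?_
  refine Cofan.IsColimit.mk _
    (fun s => AddCommGrpCat.ofHom (ht.desc fun j => (s.inj j).hom)) ?_ ?_
  · intro s j
    ext ψ
    exact ht.desc_ι (fun j => (s.inj j).hom) j ψ
  · intro s m hm
    apply AddCommGrpCat.hom_ext
    refine ht.hom_ext fun j ψ => ?_
    refine (congr($(hm j).hom ψ) : _).trans ?_
    exact (ht.desc_ι (fun j => (s.inj j).hom) j ψ).symm

end FactorsFinitely

lemma compactObjects_iff_factorsFinitely [HasCoproducts.{v} C] (t : C) :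
    compactObjects C t ↔ FactorsFinitely t :=
  ⟨fun h => h.factorsFinitely, fun h => h.compactObjects⟩

end Coproducts

end TensorTriangular

namespace TensorTriangular

/-! ### Compact objects of a triangulated category. -/

section Triangulated

variable {C : Type u₁} [Category.{v} C] [Preadditive C] [HasZeroObject C] [HasShift C ℤ]
  [∀ n : ℤ, (shiftFunctor C n).Additive] [Pretriangulated C]

/-- Discarding the finitely many summands that meet the restriction of φ to `T.obj₁` leaves a map
which factors through `T.obj₃`; finitely many more summands then account for it. -/
lemma FactorsFinitely.of_distinguished₂ [HasCoproducts.{v} C] (T : Triangle C)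
    (hT : T ∈ distTriang C) (h₁ : FactorsFinitely T.obj₁) (h₃ : FactorsFinitely T.obj₃) :
    FactorsFinitely T.obj₂ := by
  classical
  intro J x φ
  obtain ⟨S, hS⟩ := h₁ x (T.mor₁ ≫ φ)
  obtain ⟨χ, hχ⟩ := T.yoneda_exact₂ hT (φ ≫ (𝟙 _ - finiteProjection x S)) (by
    rw [← assoc, Preadditive.comp_sub, hS, comp_id, sub_self])
  obtain ⟨S', hS'⟩ := h₃ x χ
  refine ⟨S ∪ S', ?_⟩
  have h : φ ≫ (𝟙 _ - finiteProjection x (S ∪ S')) = 0 := by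
    rw [← finiteProjection_comp, reassoc_of% hχ, Preadditive.comp_sub, hS', comp_id, sub_self,
      comp_zero]
  rw [Preadditive.comp_sub, comp_id, sub_eq_zero] at h
  exact h.symm

variable (C) in
/-- The adjunction between two opposite shifts. -/
noncomputable def shiftAdjunction (n : ℤ) : shiftFunctor C n ⊣ shiftFunctor C (-n) :=
  (shiftEquiv C n).toAdjunction

variable (C) in
/-- The adjunction between two opposite shifts. -/
noncomputable def shiftAdjunction' (n : ℤ) : shiftFunctor C (-n) ⊣ shiftFunctor C n :=
  (shiftEquiv C n).symm.toAdjunction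

lemma compactObjects_shift (t : C) (ht : compactObjects C t) (n : ℤ) :
    compactObjects C (t⟦n⟧) := by
  intro J
  have := ht J
  let e : shiftFunctor C (-n) ⋙ preadditiveCoyoneda.obj (op t) ≅
      preadditiveCoyoneda.obj (op (t⟦n⟧)) :=
    NatIso.ofComponents (fun y => AddEquiv.toAddCommGrpIso
      ((shiftAdjunction C n).homAddEquiv t y).symm) (fun {y y'} g => by
        ext φ
        exact (shiftAdjunction C n).homEquiv_naturality_right_symm φ g)
  exact preservesColimitsOfShape_of_natIso e

instance : (compactObjects C).IsClosedUnderIsomorphisms where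
  of_iso {x y} e h J := by
    have := h J
    exact preservesColimitsOfShape_of_natIso (preadditiveCoyoneda.mapIso e.symm.op)

lemma isStableUnderRetracts_compactObjects [HasCoproducts.{v} C] :
    (compactObjects C).IsStableUnderRetracts where
  of_retract {x y} r h := by
    rw [compactObjects_iff_factorsFinitely] at h ⊢
    intro J z φ
    obtain ⟨S, hS⟩ := h z (r.r ≫ φ)
    exact ⟨S, by simpa using r.i ≫= hS⟩

lemma compactObjects_of_isZero {x : C} (hx : IsZero x) [HasCoproducts.{v} C] :
    compactObjects C x := by
  rw [compactObjects_iff_factorsFinitely]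
  intro J z φ
  exact ⟨∅, hx.eq_of_src _ _⟩

lemma isTriangulated_compactObjects [HasCoproducts.{v} C] :
    (compactObjects C).IsTriangulated where
  exists_zero := ⟨_, isZero_zero C, compactObjects_of_isZero (isZero_zero C)⟩
  isStableUnderShiftBy n := ⟨fun t ht => compactObjects_shift t ht n⟩
  ext₂' T hT h₁ h₃ := by
    rw [ObjectProperty.isoClosure_eq_self]
    rw [compactObjects_iff_factorsFinitely] at h₁ h₃ ⊢
    exact FactorsFinitely.of_distinguished₂ T hT h₁ h₃

/-- Closed under isomorphisms, cones and coproducts. -/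
structure IsLocalizing (P : ObjectProperty C) : Prop where
  of_iso : ∀ {x y : C}, (x ≅ y) → P x → P y
  cone : ∀ T ∈ distTriang C, P T.obj₁ → P T.obj₂ → P T.obj₃
  coproduct : ∀ [HasCoproducts.{v} C] (J : Type v) (x : J → C), (∀ j, P (x j)) → P (∐ x)

lemma isLocalizing_top : IsLocalizing (⊤ : ObjectProperty C) :=
  ⟨fun _ _ => trivial, fun _ _ _ _ => trivial, fun _ _ _ => trivial⟩

variable {S : Type u₂} [Category.{v} S] [Preadditive S] [HasZeroObject S] [HasShift S ℤ]
  [∀ n : ℤ, (shiftFunctor S n).Additive] [Pretriangulated S]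

/-! ### Brown representability for Hom(F -, c), and induction from compact generators. -/

section Representability

variable (F : C ⥤ S) (c : S) (P : ObjectProperty C)

/-- An object `t` satisfying `P` with a morphism `F t ⟶ c`. -/
structure Stage where
  t : C
  ε : F.obj t ⟶ c
  mem : P t

variable {F c P}

lemma PreservesCoproducts.exists_desc [HasCoproducts.{v} C] (hF : PreservesCoproducts F)
    {J : Type v} (x : J → C) {y : S} (k : ∀ j, F.obj (x j) ⟶ y) :
    ∃ l : F.obj (∐ x) ⟶ y, ∀ j, F.map (Sigma.ι x j) ≫ l = k j := by
  have := hF J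
  let h := isColimitOfHasCoproductOfPreservesColimit F x
  exact ⟨Cofan.IsColimit.desc h k, fun j => Cofan.IsColimit.fac h k j⟩

lemma PreservesCoproducts.hom_ext [HasCoproducts.{v} C] (hF : PreservesCoproducts F)
    {J : Type v} (x : J → C) {y : S} {k l : F.obj (∐ x) ⟶ y}
    (h : ∀ j, F.map (Sigma.ι x j) ≫ k = F.map (Sigma.ι x j) ≫ l) : k = l := by
  have := hF J
  exact Cofan.IsColimit.hom_ext (isColimitOfHasCoproductOfPreservesColimit F x) _ _ h

variable [F.CommShift ℤ] [F.IsTriangulated]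

lemma exists_extension_to_cone {x y z : C} {a : x ⟶ y} {b : y ⟶ z} {d : z ⟶ x⟦(1 : ℤ)⟧}
    (hT : Triangle.mk a b d ∈ distTriang C) (ε : F.obj y ⟶ c) (h : F.map a ≫ ε = 0) :
    ∃ ε' : F.obj z ⟶ c, F.map b ≫ ε' = ε := by
  obtain ⟨ε', h'⟩ := Triangle.yoneda_exact₂ _ (F.map_distinguished _ hT) ε h
  exact ⟨ε', h'.symm⟩

/-- The next stage is the cone of the coproduct of all maps from generators on which the transpose
vanishes. The structure map extends over the cone since it kills that coproduct. -/
lemma Stage.exists_next [HasCoproducts.{v} C] (hF : PreservesCoproducts F) (hP : IsLocalizing P)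
    {I : Type v} (g : I → C) (hg : ∀ i, P (g i)) (X : Stage F c P) :
    ∃ (Y : Stage F c P) (f : X.t ⟶ Y.t), F.map f ≫ Y.ε = X.ε ∧
      ∀ i (k : g i ⟶ X.t), F.map k ≫ X.ε = 0 → k ≫ f = 0 := by
  let J := Σ i, { k : g i ⟶ X.t // F.map k ≫ X.ε = 0 }
  let x : J → C := fun j => g j.1
  let a : ∐ x ⟶ X.t := Sigma.desc fun j => j.2.1
  obtain ⟨z, b, d, hT⟩ := distinguished_cocone_triangle a
  obtain ⟨ε', hε'⟩ := exists_extension_to_cone hT X.ε (hF.hom_ext x fun j => by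
    rw [← assoc, ← F.map_comp, Sigma.ι_desc, comp_zero]
    exact j.2.2)
  refine ⟨⟨z, ε', hP.cone _ hT (hP.coproduct _ _ fun j => hg _) X.mem⟩, b, hε', ?_⟩
  intro i k hk
  have h₁ : Sigma.ι x ⟨i, k, hk⟩ ≫ a = k := Sigma.ι_desc _ _
  have h₂ : a ≫ b = 0 := comp_distTriang_mor_zero₁₂ _ hT
  rw [← h₁, assoc]
  exact (congrArg (Sigma.ι x ⟨i, k, hk⟩ ≫ ·) h₂).trans comp_zero

lemma Stage.exists_initial [HasCoproducts.{v} C] (hF : PreservesCoproducts F) (c : S)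
    (hP : IsLocalizing P) {I : Type v} (g : I → C) (hg : ∀ i, P (g i)) :
    ∃ X : Stage F c P, ∀ i (y : F.obj (g i) ⟶ c), ∃ k : g i ⟶ X.t, F.map k ≫ X.ε = y := by
  let J := Σ i, (F.obj (g i) ⟶ c)
  let x : J → C := fun j => g j.1
  obtain ⟨ε, hε⟩ := hF.exists_desc x (fun j => j.2)
  exact ⟨⟨∐ x, ε, hP.coproduct _ _ fun j => hg _⟩, fun i y => ⟨Sigma.ι x ⟨i, y⟩, hε ⟨i, y⟩⟩⟩

section Hocolim

variable [HasCoproducts.{v} C] (x : ℕ → C) (f : ∀ n, x n ⟶ x (n + 1))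

/-- The shift map of the coproduct of a sequence. -/
noncomputable def telescopeShift :
    (∐ fun n : ULift.{v} ℕ => x n.down) ⟶ ∐ fun n : ULift.{v} ℕ => x n.down :=
  Sigma.desc fun n => f n.down ≫ Sigma.ι (fun n : ULift.{v} ℕ => x n.down) ⟨n.down + 1⟩

@[simp]
lemma ι_telescopeShift (n : ℕ) :
    Sigma.ι (fun n : ULift.{v} ℕ => x n.down) ⟨n⟩ ≫ telescopeShift x f =
      f n ≫ Sigma.ι (fun n : ULift.{v} ℕ => x n.down) ⟨n + 1⟩ :=
  Sigma.ι_desc _ _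

@[simp]
lemma ι_telescopeShift_assoc (n : ℕ) {y : C}
    (k : (∐ fun n : ULift.{v} ℕ => x n.down) ⟶ y) :
    Sigma.ι (fun n : ULift.{v} ℕ => x n.down) ⟨n⟩ ≫ telescopeShift x f ≫ k =
      f n ≫ Sigma.ι (fun n : ULift.{v} ℕ => x n.down) ⟨n + 1⟩ ≫ k := by
  rw [← assoc, ι_telescopeShift, assoc]

/-- The shift has no component 0, and component m + 1 of ψ is component m followed by f m; so all
components vanish by induction. Compactness ensures that a map with no components is zero. -/
lemma eq_zero_of_comp_telescopeShift_eq {g : C} (hg : compactObjects C g)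
    (ψ : g ⟶ ∐ fun n : ULift.{v} ℕ => x n.down) (h : ψ ≫ telescopeShift x f = ψ) : ψ = 0 := by
  have h₀ : telescopeShift x f ≫
      coproductProjection (fun n : ULift.{v} ℕ => x n.down) ⟨0⟩ = 0 := by
    ext ⟨n⟩
    rw [ι_telescopeShift_assoc, ι_coproductProjection_of_ne _ (by simp), comp_zero, comp_zero]
  have h₁ (m : ℕ) : telescopeShift x f ≫
      coproductProjection (fun n : ULift.{v} ℕ => x n.down) ⟨m + 1⟩ =
      coproductProjection (fun n : ULift.{v} ℕ => x n.down) ⟨m⟩ ≫ f m := by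
    ext ⟨n⟩
    rw [ι_telescopeShift_assoc]
    by_cases hn : n = m
    · subst hn
      rw [ι_coproductProjection_self, ι_coproductProjection_self_assoc, comp_id]
    · rw [ι_coproductProjection_of_ne _ (by simpa using hn),
        ι_coproductProjection_of_ne_assoc _ (by simpa using hn), comp_zero, zero_comp]
  have h₂ (m : ℕ) : ψ ≫ coproductProjection (fun n : ULift.{v} ℕ => x n.down) ⟨m⟩ = 0 := by
    induction m with
    | zero => rw [← h, assoc, h₀, comp_zero]
    | succ m hm => rw [← h, assoc, h₁, reassoc_of% hm, zero_comp]
  obtain ⟨N, hN⟩ := hg.factorsFinitely _ ψ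
  rw [← hN, finiteProjection_eq_sum, Preadditive.comp_sum]
  exact Finset.sum_eq_zero fun j _ => by rw [← assoc, h₂, zero_comp]

/-- Homomorphisms from a compact object to the homotopy colimit of a sequence factor through
a term of the sequence. -/
lemma exists_factorization_of_telescope {g : C} (hg : compactObjects C g) {t : C}
    {h : (∐ fun n : ULift.{v} ℕ => x n.down) ⟶ t} {d : t ⟶ _}
    (hT : Triangle.mk (𝟙 _ - telescopeShift x f) h d ∈ distTriang C) (k : g ⟶ t) :
    ∃ (N : ℕ) (k' : g ⟶ x N), k = k' ≫ Sigma.ι (fun n : ULift.{v} ℕ => x n.down) ⟨N⟩ ≫ h := by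
  have hι (n : ℕ) : Sigma.ι (fun n : ULift.{v} ℕ => x n.down) ⟨n⟩ ≫ h =
      f n ≫ Sigma.ι (fun n : ULift.{v} ℕ => x n.down) ⟨n + 1⟩ ≫ h := by
    have h₀ : (𝟙 _ - telescopeShift x f) ≫ h = 0 := comp_distTriang_mor_zero₁₂ _ hT
    rw [Preadditive.sub_comp, sub_eq_zero, id_comp] at h₀
    conv_lhs => rw [h₀]
    rw [ι_telescopeShift_assoc]
  have hι' (n m : ℕ) (k' : g ⟶ x n) : ∃ k'' : g ⟶ x (n + m),
      k' ≫ Sigma.ι (fun n : ULift.{v} ℕ => x n.down) ⟨n⟩ ≫ h =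
        k'' ≫ Sigma.ι (fun n : ULift.{v} ℕ => x n.down) ⟨n + m⟩ ≫ h := by
    induction m with
    | zero => exact ⟨k', rfl⟩
    | succ m hm =>
      obtain ⟨k'', hk''⟩ := hm
      exact ⟨k'' ≫ f _, by rw [hk'', hι]; simp only [assoc]; rfl⟩
  -- Maps through a single term form a subgroup, because two terms n and m can both be moved to n +
  -- m. It then suffices to write k as a finite sum of such maps.
  let R : AddSubgroup (g ⟶ t) :=
    { carrier := {k | ∃ (N : ℕ) (k' : g ⟶ x N),
        k = k' ≫ Sigma.ι (fun n : ULift.{v} ℕ => x n.down) ⟨N⟩ ≫ h}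
      zero_mem' := ⟨0, 0, by simp⟩
      add_mem' := by
        rintro _ _ ⟨n, a, rfl⟩ ⟨m, b, rfl⟩
        obtain ⟨a', ha'⟩ := hι' n m a
        obtain ⟨b', hb'⟩ : ∃ b' : g ⟶ x (n + m),
            b ≫ Sigma.ι (fun n : ULift.{v} ℕ => x n.down) ⟨m⟩ ≫ h =
              b' ≫ Sigma.ι (fun n : ULift.{v} ℕ => x n.down) ⟨n + m⟩ ≫ h := by
          rw [add_comm n m]
          exact hι' m n b
        exact ⟨n + m, a' + b', by rw [Preadditive.add_comp, ha', hb']⟩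
      neg_mem' := by
        rintro _ ⟨n, a, rfl⟩
        exact ⟨n, -a, by simp⟩ }
  change k ∈ R
  -- The boundary `k ≫ d` is killed by the suspension of 1 - shift, so its desuspension is fixed by
  -- the shift.
  have hd : k ≫ d = 0 := by
    let y := ∐ fun n : ULift.{v} ℕ => x n.down
    let E := ((shiftAdjunction' C (1 : ℤ)).homAddEquiv g y).symm
    apply E.injective
    rw [map_zero]
    refine eq_zero_of_comp_telescopeShift_eq x f (compactObjects_shift g hg (-1)) _ ?_
    have h₀ : (k ≫ d) ≫ (𝟙 _ - telescopeShift x f)⟦(1 : ℤ)⟧' = 0 := by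
      rw [assoc, show d ≫ (𝟙 _ - telescopeShift x f)⟦(1 : ℤ)⟧' = 0 from
        comp_distTriang_mor_zero₃₁ _ hT, comp_zero]
    have h₁ : E (k ≫ d) ≫ (𝟙 y - telescopeShift x f) = 0 :=
      ((shiftAdjunction' C (1 : ℤ)).homEquiv_naturality_right_symm (k ≫ d)
        (𝟙 y - telescopeShift x f)).symm.trans ((congrArg E h₀).trans (map_zero E))
    rw [Preadditive.comp_sub, comp_id, sub_eq_zero] at h₁
    exact h₁.symm
  obtain ⟨κ, hκ⟩ : ∃ κ : g ⟶ _, k = κ ≫ h := Triangle.coyoneda_exact₃ _ hT k hd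
  rw [hκ]
  obtain ⟨N, hN⟩ := hg.factorsFinitely _ κ
  rw [← hN, finiteProjection_eq_sum, Preadditive.comp_sum, Preadditive.sum_comp]
  refine R.sum_mem fun j _ => ⟨j.down, κ ≫ coproductProjection _ j, ?_⟩
  simp

end Hocolim

/-- The homotopy colimit of the stages works: surjectivity is already present at the initial stage,
and an element of the kernel comes from some term by compactness and dies in the next one. Closure
of P under cones and coproducts keeps the colimit in P, so the same construction serves for
induction and for representability. -/
lemma Stage.exists_bijective [HasCoproducts.{v} C] (hF : PreservesCoproducts F) (c : S)
    (hP : IsLocalizing P) {I : Type v} (g : I → C) (hg : ∀ i, P (g i))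
    (hc : ∀ i, compactObjects C (g i)) :
    ∃ X : Stage F c P, ∀ i, Function.Bijective fun k : g i ⟶ X.t => F.map k ≫ X.ε := by
  choose next f hf hf' using Stage.exists_next (c := c) hF hP g hg
  obtain ⟨X₀, hX₀⟩ := Stage.exists_initial hF c hP g hg
  let X (n : ℕ) : Stage F c P := next^[n] X₀
  have hX (n : ℕ) : X (n + 1) = next (X n) := Function.iterate_succ_apply' _ _ _
  obtain ⟨a, ha, ha'⟩ : ∃ a : ∀ n, (X n).t ⟶ (X (n + 1)).t,
      (∀ n, F.map (a n) ≫ (X (n + 1)).ε = (X n).ε) ∧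
      ∀ n i (k : g i ⟶ (X n).t), F.map k ≫ (X n).ε = 0 → k ≫ a n = 0 := by
    have (n : ℕ) : ∃ a : (X n).t ⟶ (X (n + 1)).t, F.map a ≫ (X (n + 1)).ε = (X n).ε ∧
        ∀ i (k : g i ⟶ (X n).t), F.map k ≫ (X n).ε = 0 → k ≫ a = 0 := by
      rw [hX]
      exact ⟨f (X n), hf _, hf' _⟩
    choose a ha ha' using this
    exact ⟨a, ha, ha'⟩
  let x (n : ℕ) : C := (X n).t
  let ι (n : ℕ) : x n ⟶ ∐ fun n : ULift.{v} ℕ => x n.down :=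
    Sigma.ι (fun n : ULift.{v} ℕ => x n.down) ⟨n⟩
  have hι (n : ℕ) : ι n ≫ telescopeShift x a = a n ≫ ι (n + 1) := ι_telescopeShift x a n
  obtain ⟨t, h, d, hT⟩ := distinguished_cocone_triangle (𝟙 _ - telescopeShift x a)
  obtain ⟨ε', hε'⟩ : ∃ ε' : F.obj (∐ fun n : ULift.{v} ℕ => x n.down) ⟶ c,
      ∀ n, F.map (ι n) ≫ ε' = (X n).ε := by
    obtain ⟨ε', hε'⟩ := hF.exists_desc (fun n : ULift.{v} ℕ => x n.down) (fun n => (X n.down).ε)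
    exact ⟨ε', fun n => hε' ⟨n⟩⟩
  obtain ⟨ε, hε⟩ := exists_extension_to_cone hT ε' (hF.hom_ext _ fun ⟨n⟩ => by
    change F.map (ι n) ≫ _ = F.map (ι n) ≫ _
    rw [← assoc, ← F.map_comp, Preadditive.comp_sub, hι, comp_id, F.map_sub, Preadditive.sub_comp,
      F.map_comp, assoc, hε', hε', ha, sub_self, comp_zero])
  have hε'' (n : ℕ) : F.map (ι n ≫ h) ≫ ε = (X n).ε := by
    rw [F.map_comp, assoc, hε, hε']
  have ht : P t := hP.cone _ hT (hP.coproduct _ _ fun n => (X n.down).mem)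
    (hP.coproduct _ _ fun n => (X n.down).mem)
  refine ⟨⟨t, ε, ht⟩, fun i => ⟨?_, fun y => ?_⟩⟩
  · suffices ∀ k : g i ⟶ t, F.map k ≫ ε = 0 → k = 0 by
      intro k l hkl
      have hkl' : F.map k ≫ ε = F.map l ≫ ε := hkl
      rw [← sub_eq_zero]
      refine this _ ?_
      rw [F.map_sub, Preadditive.sub_comp, hkl', sub_self]
    intro k hk
    obtain ⟨N, k', rfl⟩ := exists_factorization_of_telescope x a (hc i) hT k
    change F.map (k' ≫ ι N ≫ h) ≫ ε = 0 at hk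
    change k' ≫ ι N ≫ h = 0
    rw [F.map_comp, assoc, hε''] at hk
    have h₀ : ι N ≫ h = a N ≫ ι (N + 1) ≫ h := by
      have h₁ : (𝟙 _ - telescopeShift x a) ≫ h = 0 := comp_distTriang_mor_zero₁₂ _ hT
      rw [Preadditive.sub_comp, sub_eq_zero, id_comp] at h₁
      conv_lhs => rw [h₁]
      rw [reassoc_of% hι]
    rw [h₀, ← assoc, ha' N i k' hk, zero_comp]
  · obtain ⟨k, hk⟩ := hX₀ i y
    refine ⟨k ≫ ι 0 ≫ h, ?_⟩
    change F.map (k ≫ ι 0 ≫ h) ≫ ε = y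
    rw [F.map_comp, assoc]
    exact (congrArg (F.map k ≫ ·) (hε'' 0)).trans hk

/-- A set of compact generators closed under shifts. -/
lemma IsCompactlyGeneratedCategory.exists_family (hC : IsCompactlyGeneratedCategory C) :
    ∃ (I : Type v) (g : I → C), (∀ i, compactObjects C (g i)) ∧
      (∀ t : C, (∀ i (φ : g i ⟶ t), φ = 0) → IsZero t) ∧
      ∀ i (n : ℤ), ∃ j, Nonempty ((g i)⟦n⟧ ≅ g j) := by
  obtain ⟨𝒢, h𝒢, h₁, h₂⟩ := hC.exists_generators
  have : Small.{v} (Subtype 𝒢) := h𝒢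
  refine ⟨Shrink.{v} (Subtype 𝒢) × ULift.{v} ℤ,
    fun i => ((equivShrink (Subtype 𝒢)).symm i.1).1⟦i.2.down⟧, fun i =>
      compactObjects_shift _ (h₁ _ ((equivShrink (Subtype 𝒢)).symm i.1).2) _, fun t ht => ?_,
    fun i n => ⟨⟨i.1, ⟨i.2.down + n⟩⟩, ⟨((shiftFunctorAdd C _ _).app _).symm⟩⟩⟩
  refine h₂ t fun g hg φ => ?_
  obtain ⟨j, hj⟩ := (equivShrink (Subtype 𝒢)).symm.surjective ⟨g, hg⟩
  -- The family consists of all shifts of the given generators; shift 0 recovers the generators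
  -- themselves.
  have h : ∀ φ : ((equivShrink (Subtype 𝒢)).symm j).1⟦(0 : ℤ)⟧ ⟶ t, φ = 0 := ht ⟨j, ⟨0⟩⟩
  rw [hj] at h
  rw [← cancel_epi ((shiftFunctorZero C ℤ).hom.app g), comp_zero]
  exact h _

/-- A map from a generator to the cone of a has zero boundary by injectivity on a desuspended
generator. Hence it lifts to y, and by surjectivity further to x, so it is zero. -/
lemma isIso_of_bijective {I : Type*} {g : I → C}
    (hg : ∀ t : C, (∀ i (φ : g i ⟶ t), φ = 0) → IsZero t)
    (hg' : ∀ i (n : ℤ), ∃ j, Nonempty ((g i)⟦n⟧ ≅ g j)) {x y : C} (a : x ⟶ y)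
    (h : ∀ i, Function.Bijective fun k : g i ⟶ x => k ≫ a) : IsIso a := by
  obtain ⟨z, b, d, hT⟩ := distinguished_cocone_triangle a
  refine (Triangle.isZero₃_iff_isIso₁ _ hT).1 (hg z fun i φ => ?_)
  have hd : φ ≫ d = 0 := by
    let E := ((shiftAdjunction' C (1 : ℤ)).homAddEquiv (g i) x).symm
    let E' := ((shiftAdjunction' C (1 : ℤ)).homAddEquiv (g i) y).symm
    obtain ⟨j, ⟨e⟩⟩ := hg' i (-1)
    apply E.injective
    rw [map_zero]
    have h₀ : (φ ≫ d) ≫ a⟦(1 : ℤ)⟧' = 0 := by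
      rw [assoc, show d ≫ a⟦(1 : ℤ)⟧' = 0 from comp_distTriang_mor_zero₃₁ _ hT, comp_zero]
    have h₁ : E (φ ≫ d) ≫ a = 0 :=
      ((shiftAdjunction' C (1 : ℤ)).homEquiv_naturality_right_symm (φ ≫ d) a).symm.trans
        ((congrArg E' h₀).trans (map_zero E'))
    rw [← cancel_epi e.inv, comp_zero]
    apply (h j).1
    change (e.inv ≫ E (φ ≫ d)) ≫ a = 0 ≫ a
    rw [assoc, h₁, comp_zero, zero_comp]
  obtain ⟨ψ, hψ⟩ : ∃ ψ : g i ⟶ y, φ = ψ ≫ b := Triangle.coyoneda_exact₃ _ hT φ hd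
  obtain ⟨χ, hχ⟩ := (h i).2 ψ
  have hχ' : χ ≫ a = ψ := hχ
  rw [hψ, ← hχ', assoc, show a ≫ b = 0 from comp_distTriang_mor_zero₁₂ _ hT, comp_zero]

lemma IsCompactlyGeneratedCategory.isIso (hC : IsCompactlyGeneratedCategory C) {x y : C}
    (a : x ⟶ y)
    (h : ∀ g, compactObjects C g → Function.Bijective fun k : g ⟶ x => k ≫ a) : IsIso a := by
  obtain ⟨I, g, hg, h₁, h₂⟩ := hC.exists_family
  exact isIso_of_bijective h₁ h₂ a fun i => h _ (hg i)

lemma preservesCoproducts_id : PreservesCoproducts (𝟭 C) := fun _ => inferInstance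

/-- Taking F to be the identity, the representing object built inside P maps isomorphically to y. -/
lemma induction_of_family [HasCoproducts.{v} C] {I : Type v} {g : I → C}
    (hc : ∀ i, compactObjects C (g i)) (hg : ∀ t : C, (∀ i (φ : g i ⟶ t), φ = 0) → IsZero t)
    (hg' : ∀ i (n : ℤ), ∃ j, Nonempty ((g i)⟦n⟧ ≅ g j)) {P : ObjectProperty C}
    (hP : IsLocalizing P) (h : ∀ i, P (g i)) (y : C) : P y := by
  obtain ⟨X, hX⟩ := Stage.exists_bijective preservesCoproducts_id y hP g h hc
  have : IsIso (show X.t ⟶ y from X.ε) := isIso_of_bijective hg hg' _ hX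
  exact hP.of_iso (asIso (show X.t ⟶ y from X.ε)) X.mem

/-- A localizing class which contains the compact objects contains all objects. -/
lemma IsCompactlyGeneratedCategory.induction (hC : IsCompactlyGeneratedCategory C)
    {P : ObjectProperty C} (hP : IsLocalizing P) (h : ∀ g, compactObjects C g → P g) (y : C) :
    P y := by
  have := hC.hasCoproducts
  obtain ⟨I, g, hg, h₁, h₂⟩ := hC.exists_family
  exact induction_of_family hg h₁ h₂ hP (fun i => h _ (hg i)) y

/-- The five lemma on a triangle also needs the suspended terms; requiring Q of all shifts makes
them available. -/
lemma IsLocalizing.of_shifts {Q : ObjectProperty C} (h₁ : ∀ {x y : C}, (x ≅ y) → Q x → Q y)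
    (h₂ : ∀ T ∈ distTriang C, Q T.obj₁ → Q T.obj₂ → Q (T.obj₁⟦(1 : ℤ)⟧) →
      Q (T.obj₂⟦(1 : ℤ)⟧) → Q T.obj₃)
    (h₃ : ∀ [HasCoproducts.{v} C] (J : Type v) (x : J → C), (∀ j, Q (x j)) → Q (∐ x)) :
    IsLocalizing (fun y => ∀ n : ℤ, Q (y⟦n⟧) : ObjectProperty C) where
  of_iso e h n := h₁ ((shiftFunctor C n).mapIso e) (h n)
  cone T hT hx hy n := h₂ _ (Triangle.shift_distinguished T hT n) (hx n) (hy n)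
    (h₁ ((shiftFunctorAdd C n 1).app _) (hx (n + 1)))
    (h₁ ((shiftFunctorAdd C n 1).app _) (hy (n + 1)))
  coproduct _ x hx n :=
    h₁ (PreservesCoproduct.iso (shiftFunctor C n) x).symm (h₃ _ _ fun j => hx j n)

variable (F) in
/-- The homomorphism `Hom(y, t) ⟶ Hom(F y, c)` given by `ε : F t ⟶ c`. -/
def transposeHom {t : C} (ε : F.obj t ⟶ c) (y : C) : (y ⟶ t) →+ (F.obj y ⟶ c) where
  toFun k := F.map k ≫ ε
  map_zero' := by simp
  map_add' k l := by simp

lemma transposeHom_comp {t : C} (ε : F.obj t ⟶ c) {y y' : C} (a : y ⟶ y') (k : y' ⟶ t) :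
    transposeHom F ε y (a ≫ k) = F.map a ≫ transposeHom F ε y' k := by
  simp [transposeHom]

/-- Precomposition as a homomorphism. -/
def precompHom (t : S) {y y' : S} (a : y ⟶ y') : (y' ⟶ t) →+ (y ⟶ t) where
  toFun k := a ≫ k
  map_zero' := comp_zero
  map_add' := Preadditive.comp_add _ _ _ _

lemma precompHom_exact (F : C ⥤ S) [F.CommShift ℤ] [F.IsTriangulated] (t : S) (T : Triangle C)
    (hT : T ∈ distTriang C) :
    Function.Exact (precompHom t (F.map T.mor₂)) (precompHom t (F.map T.mor₁)) := by
  intro φ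
  constructor
  · intro h
    obtain ⟨ψ, hψ⟩ := Triangle.yoneda_exact₂ _ (F.map_distinguished T hT) φ h
    exact ⟨ψ, hψ.symm⟩
  · rintro ⟨ψ, rfl⟩
    change F.map T.mor₁ ≫ F.map T.mor₂ ≫ ψ = 0
    rw [← assoc, ← F.map_comp, comp_distTriang_mor_zero₁₂ _ hT, F.map_zero, zero_comp]

/-- This is the five lemma for the long exact sequences of Hom(-, t) and Hom(F -, c), with the third
object in the middle. -/
lemma bijective_transposeHom_of_distinguished {t : C} (ε : F.obj t ⟶ c) (T : Triangle C)
    (hT : T ∈ distTriang C) (h₁ : Function.Bijective (transposeHom F ε T.obj₁))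
    (h₂ : Function.Bijective (transposeHom F ε T.obj₂))
    (h₁' : Function.Bijective (transposeHom F ε (T.obj₁⟦(1 : ℤ)⟧)))
    (h₂' : Function.Bijective (transposeHom F ε (T.obj₂⟦(1 : ℤ)⟧))) :
    Function.Bijective (transposeHom F ε T.obj₃) := by
  have hT' := rot_of_distTriang _ hT
  have hT'' := rot_of_distTriang _ hT'
  have nat {y y' : C} (a : y ⟶ y') : (precompHom c (F.map a)).comp (transposeHom F ε y') =
      (transposeHom F ε y).comp (precompHom t ((𝟭 C).map a)) := by
    ext k
    exact (transposeHom_comp ε a k).symm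
  exact AddMonoidHom.bijective_of_surjective_of_bijective_of_bijective_of_injective
    (precompHom t ((𝟭 C).map T.rotate.rotate.mor₂)) (precompHom t ((𝟭 C).map T.rotate.mor₂))
    (precompHom t ((𝟭 C).map T.mor₂)) (precompHom t ((𝟭 C).map T.mor₁))
    (precompHom c (F.map T.rotate.rotate.mor₂)) (precompHom c (F.map T.rotate.mor₂))
    (precompHom c (F.map T.mor₂)) (precompHom c (F.map T.mor₁))
    (transposeHom F ε (T.obj₂⟦(1 : ℤ)⟧)) (transposeHom F ε (T.obj₁⟦(1 : ℤ)⟧))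
    (transposeHom F ε T.obj₃) (transposeHom F ε T.obj₂) (transposeHom F ε T.obj₁)
    (nat _) (nat _) (nat _) (nat _)
    (precompHom_exact (𝟭 C) t _ hT'') (precompHom_exact (𝟭 C) t _ hT')
    (precompHom_exact (𝟭 C) t _ hT)
    (precompHom_exact F c _ hT'') (precompHom_exact F c _ hT') (precompHom_exact F c _ hT)
    h₂'.2 h₁' h₂ h₁.1

lemma bijective_transposeHom_of_iso {t : C} (ε : F.obj t ⟶ c) {y y' : C} (e : y ≅ y')
    (h : Function.Bijective (transposeHom F ε y)) : Function.Bijective (transposeHom F ε y') := by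
  constructor
  · intro k l hkl
    rw [← cancel_epi e.hom]
    apply h.1
    rw [transposeHom_comp, transposeHom_comp, hkl]
  · intro φ
    obtain ⟨k, hk⟩ := h.2 (F.map e.hom ≫ φ)
    exact ⟨e.inv ≫ k, by rw [transposeHom_comp, hk, ← assoc, ← F.map_comp]; simp⟩

/-- Brown representability for `Hom(F -, c)`. -/
lemma IsCompactlyGeneratedCategory.exists_universal (hC : IsCompactlyGeneratedCategory C)
    (hF : PreservesCoproducts F) (c : S) :
    ∃ (t : C) (ε : F.obj t ⟶ c), ∀ y, Function.Bijective (transposeHom F ε y) := by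
  have := hC.hasCoproducts
  obtain ⟨I, g, hg, h₁, h₂⟩ := hC.exists_family
  obtain ⟨X, hX⟩ := Stage.exists_bijective hF c isLocalizing_top g (fun _ => trivial) hg
  refine ⟨X.t, X.ε, fun y => ?_⟩
  have hP : IsLocalizing (fun y => ∀ n : ℤ, Function.Bijective (transposeHom F X.ε (y⟦n⟧)) :
      ObjectProperty C) :=
    IsLocalizing.of_shifts (Q := fun y => Function.Bijective (transposeHom F X.ε y))
      (bijective_transposeHom_of_iso X.ε)
      (fun T hT h₁ h₂ h₃ h₄ => bijective_transposeHom_of_distinguished X.ε T hT h₁ h₂ h₃ h₄)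
      (fun J x h => by
        constructor
        · intro k l hkl
          refine Sigma.hom_ext _ _ fun j => (h j).1 ?_
          rw [transposeHom_comp, transposeHom_comp, hkl]
        · intro φ
          choose k hk using fun j => (h j).2 (F.map (Sigma.ι x j) ≫ φ)
          refine ⟨Sigma.desc k, hF.hom_ext _ fun j => ?_⟩
          rw [← transposeHom_comp, Sigma.ι_desc, hk])
  have := induction_of_family hg h₁ h₂ hP (fun i n => by
    obtain ⟨j, ⟨e⟩⟩ := h₂ i n
    exact bijective_transposeHom_of_iso X.ε e.symm (hX j)) y 0
  exact bijective_transposeHom_of_iso X.ε ((shiftFunctorZero C ℤ).app y) this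

lemma IsCompactlyGeneratedCategory.exists_rightAdjoint (hC : IsCompactlyGeneratedCategory C)
    (hF : PreservesCoproducts F) : ∃ G : S ⥤ C, Nonempty (F ⊣ G) := by
  choose t ε h using hC.exists_universal hF
  let e (y : C) (c : S) : (F.obj y ⟶ c) ≃ (y ⟶ t c) := (Equiv.ofBijective _ (h c y)).symm
  have he (y' y : C) (c : S) (a : y' ⟶ y) (k : F.obj y ⟶ c) :
      e y' c (F.map a ≫ k) = a ≫ e y c k := by
    apply (e y' c).symm.injective
    rw [Equiv.symm_apply_apply]
    refine Eq.trans ?_ (transposeHom_comp (ε c) a _).symm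
    exact congrArg (F.map a ≫ ·) ((e y c).symm_apply_apply k).symm
  exact ⟨_, ⟨Adjunction.adjunctionOfEquivRight e he⟩⟩

end Representability

/-! ### Transformations between coproduct-preserving homological functors. -/

section Transformations

variable {H₁ H₂ : C ⥤ AddCommGrpCat.{v}} [H₁.IsHomological] [H₂.IsHomological] (η : H₁ ⟶ H₂)

lemma exact_of_isHomological (H : C ⥤ AddCommGrpCat.{v}) [H.IsHomological] (T : Triangle C)
    (hT : T ∈ distTriang C) : Function.Exact (H.map T.mor₁).hom (H.map T.mor₂).hom :=
  (ShortComplex.ab_exact_iff_function_exact _).1 (H.map_distinguished_exact T hT)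

lemma bijective_app_of_distinguished (T : Triangle C)
    (hT : T ∈ distTriang C) (h₁ : Function.Bijective (η.app T.obj₁).hom)
    (h₂ : Function.Bijective (η.app T.obj₂).hom)
    (h₁' : Function.Bijective (η.app (T.obj₁⟦(1 : ℤ)⟧)).hom)
    (h₂' : Function.Bijective (η.app (T.obj₂⟦(1 : ℤ)⟧)).hom) :
    Function.Bijective (η.app T.obj₃).hom := by
  have hT' := rot_of_distTriang _ hT
  have hT'' := rot_of_distTriang _ hT'
  have nat {y y' : C} (a : y ⟶ y') :
      (H₂.map a).hom.comp (η.app y).hom = (η.app y').hom.comp (H₁.map a).hom :=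
    congrArg AddCommGrpCat.Hom.hom (η.naturality a).symm
  exact AddMonoidHom.bijective_of_surjective_of_bijective_of_bijective_of_injective
    (H₁.map T.mor₁).hom (H₁.map T.mor₂).hom (H₁.map T.rotate.mor₂).hom
    (H₁.map T.rotate.rotate.mor₂).hom
    (H₂.map T.mor₁).hom (H₂.map T.mor₂).hom (H₂.map T.rotate.mor₂).hom
    (H₂.map T.rotate.rotate.mor₂).hom
    (η.app T.obj₁).hom (η.app T.obj₂).hom (η.app T.obj₃).hom (η.app (T.obj₁⟦(1 : ℤ)⟧)).hom
    (η.app (T.obj₂⟦(1 : ℤ)⟧)).hom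
    (nat _) (nat _) (nat _) (nat _)
    (exact_of_isHomological H₁ _ hT) (exact_of_isHomological H₁ _ hT')
    (exact_of_isHomological H₁ _ hT'')
    (exact_of_isHomological H₂ _ hT) (exact_of_isHomological H₂ _ hT')
    (exact_of_isHomological H₂ _ hT'')
    h₁.2 h₂ h₁' h₂'.1

lemma isIso_app_of_iso {D : Type u₂} [Category.{v} D] {H₁ H₂ : C ⥤ D} (η : H₁ ⟶ H₂)
    {x y : C} (e : x ≅ y) (h : IsIso (η.app x)) : IsIso (η.app y) := by
  have : η.app y = H₁.map e.inv ≫ η.app x ≫ H₂.map e.hom := by simp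
  rw [this]
  infer_instance

/-- A natural transformation between homological functors which preserve coproducts is an
isomorphism if it is one on compact objects. -/
lemma IsCompactlyGeneratedCategory.isIso_app (hC : IsCompactlyGeneratedCategory C)
    (h₁ : PreservesCoproducts H₁) (h₂ : PreservesCoproducts H₂)
    (h : ∀ g, compactObjects C g → IsIso (η.app g)) (y : C) : IsIso (η.app y) := by
  have hP : IsLocalizing (fun y => ∀ n : ℤ, IsIso (η.app (y⟦n⟧)) : ObjectProperty C) :=
    IsLocalizing.of_shifts (Q := fun y => IsIso (η.app y)) (isIso_app_of_iso η)
      (fun T hT h₁ h₂ h₁' h₂' => by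
        rw [ConcreteCategory.isIso_iff_bijective] at h₁ h₂ h₁' h₂' ⊢
        exact bijective_app_of_distinguished η T hT h₁ h₂ h₁' h₂')
      (fun J x h => by
        have := h₁ J
        have := h₂ J
        have : η.app (∐ x) = (PreservesCoproduct.iso H₁ x).hom ≫
            Limits.Sigma.map (fun j => η.app (x j)) ≫ (PreservesCoproduct.iso H₂ x).inv := by
          rw [← Iso.inv_comp_eq]
          ext j
          simp
        rw [this]
        infer_instance)
  have := hC.induction hP (fun g hg n => h _ (compactObjects_shift _ hg n)) y 0
  exact isIso_app_of_iso η ((shiftFunctorZero C ℤ).app y) this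

end Transformations

end Triangulated

end TensorTriangular

namespace TensorTriangular

/-! ### Rigid objects, dual pairs, and their images under monoidal functors. -/

section Rigidity

variable {C : Type u₁} [Category.{v} C] [MonoidalCategory C] [SymmetricCategory C]
  [MonoidalClosed C]

lemma uncurry_rigidityMap {x y a : C} (h : a ⟶ (ihom x).obj (𝟙_ C) ⊗ y) :
    MonoidalClosed.uncurry (h ≫ rigidityMap x y) =
      x ◁ h ≫ (α_ x ((ihom x).obj (𝟙_ C)) y).inv ≫ (ihom.ev x).app (𝟙_ C) ▷ y ≫ (λ_ y).hom := by
  rw [MonoidalClosed.uncurry_natural_left, rigidityMap, MonoidalClosed.uncurry_curry]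

lemma comp_evaluation_eq {x d : C} {coev : 𝟙_ C ⟶ d ⊗ x} {ev : x ⊗ d ⟶ 𝟙_ C}
    (h : x ◁ coev ≫ (α_ x d x).inv ≫ ev ▷ x = (ρ_ x).hom ≫ (λ_ x).inv) :
    x ◁ (coev ▷ d ≫ (α_ d x d).hom ≫ d ◁ ev) ≫ (α_ x d (𝟙_ C)).inv ≫ ev ▷ 𝟙_ C ≫
      (λ_ (𝟙_ C)).hom = x ◁ ((λ_ d).hom ≫ (ρ_ d).inv) ≫ (α_ x d (𝟙_ C)).inv ≫
        ev ▷ 𝟙_ C ≫ (λ_ (𝟙_ C)).hom := by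
  calc _ = 𝟙 _ ⊗≫ x ◁ (coev ▷ d) ⊗≫ ((x ⊗ d) ◁ ev ≫ ev ▷ 𝟙_ C) ⊗≫ 𝟙 _ := by monoidal
    _ = 𝟙 _ ⊗≫ x ◁ (coev ▷ d) ⊗≫ (ev ▷ (x ⊗ d) ≫ 𝟙_ C ◁ ev) ⊗≫ 𝟙 _ := by
      rw [whisker_exchange]
    _ = (α_ x (𝟙_ C) d).inv ≫ (x ◁ coev ≫ (α_ x d x).inv ≫ ev ▷ x) ▷ d ≫ (α_ _ _ _).hom ≫
        (λ_ _).hom ≫ ev := by monoidal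
    _ = _ := by
      rw [h]
      monoidal

/-- A rigid object is right dual to its dual `[x, 𝟙]`. -/
lemma IsRigid.exists_exactPairing {x : C} (hx : IsRigid x) :
    ∃ e : ExactPairing ((ihom x).obj (𝟙_ C)) x, e.evaluation' = (ihom.ev x).app (𝟙_ C) := by
  have := hx x
  have := hx (𝟙_ C)
  let coev : 𝟙_ C ⟶ (ihom x).obj (𝟙_ C) ⊗ x :=
    MonoidalClosed.curry (ρ_ x).hom ≫ inv (rigidityMap x x)
  have h₁ : x ◁ coev ≫ (α_ x ((ihom x).obj (𝟙_ C)) x).inv ≫ (ihom.ev x).app (𝟙_ C) ▷ x =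
      (ρ_ x).hom ≫ (λ_ x).inv := by
    have := uncurry_rigidityMap coev
    rw [assoc, IsIso.inv_hom_id, comp_id, MonoidalClosed.uncurry_curry] at this
    rw [this]
    simp
  refine ⟨⟨coev, (ihom.ev x).app (𝟙_ C), h₁, ?_⟩, rfl⟩
  -- By rigidity the second triangle identity may be tested inside [x, 𝟙]; after uncurrying it
  -- becomes a consequence of the first.
  rw [← cancel_mono (rigidityMap x (𝟙_ C))]
  apply MonoidalClosed.uncurry_injective
  rw [uncurry_rigidityMap, uncurry_rigidityMap]
  exact comp_evaluation_eq h₁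

/-- Both d ⊗ - and [x, -] are right adjoint to x ⊗ -, giving isomorphisms d ⊗ y ≅ [x, y]. The case y
= 𝟙 identifies d with [x, 𝟙], and under this identification the general case is the rigidity map. -/
lemma isRigid_of_exactPairing (d x : C) [ExactPairing d x] : IsRigid x := by
  have key (y : C) : ∀ a, Function.Bijective fun h : a ⟶ d ⊗ y =>
      x ◁ h ≫ (α_ x d y).inv ≫ ε_ d x ▷ y ≫ (λ_ y).hom := fun a =>
    (tensorLeftHomEquiv a d x y).symm.bijective
  let k (y : C) : d ⊗ y ⟶ (ihom x).obj y :=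
    MonoidalClosed.curry ((α_ x d y).inv ≫ ε_ d x ▷ y ≫ (λ_ y).hom)
  have hk (y : C) : IsIso (k y) := by
    rw [isIso_iff_yoneda_map_bijective]
    intro a
    rw [← Function.Bijective.of_comp_iff' ((ihom.adjunction x).homEquiv a y).symm.bijective]
    refine (congrArg Function.Bijective (funext fun h => ?_)).mpr (key y a)
    change MonoidalClosed.uncurry (h ≫ k y) = _
    rw [MonoidalClosed.uncurry_natural_left, MonoidalClosed.uncurry_curry]
  let i : d ⟶ (ihom x).obj (𝟙_ C) := (ρ_ d).inv ≫ k (𝟙_ C)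
  have hi : x ◁ i ≫ (ihom.ev x).app (𝟙_ C) = ε_ d x := by
    rw [← MonoidalClosed.uncurry_eq, MonoidalClosed.uncurry_natural_left,
      MonoidalClosed.uncurry_curry]
    monoidal
  intro y
  have : k y = i ▷ y ≫ rigidityMap x y := by
    apply MonoidalClosed.uncurry_injective
    rw [uncurry_rigidityMap, MonoidalClosed.uncurry_curry, ← hi]
    monoidal
  have h' := hk y
  rw [this] at h'
  exact IsIso.of_isIso_comp_left (i ▷ y) _

end Rigidity

section Functors

variable {C : Type u₁} [Category.{v} C] [MonoidalCategory C]
  {D : Type u₂} [Category.{v} D] [MonoidalCategory D]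

open Functor.LaxMonoidal Functor.OplaxMonoidal in
/-- Strong monoidal functors preserve exact pairings. -/
@[reducible]
def exactPairingMap (F : C ⥤ D) [F.Monoidal] (x y : C) [ExactPairing x y] :
    ExactPairing (F.obj x) (F.obj y) where
  coevaluation' := ε F ≫ F.map (η_ x y) ≫ δ F x y
  evaluation' := μ F y x ≫ F.map (ε_ x y) ≫ η F
  coevaluation_evaluation' := by
    have h := congrArg F.map (ExactPairing.coevaluation_evaluation x y)
    have h₁ : F.obj y ◁ F.map (η_ x y) = μ F _ _ ≫ F.map (y ◁ η_ x y) ≫ δ F _ _ := by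
      rw [← μ_natural_right_assoc, Functor.Monoidal.μ_δ, comp_id]
    have h₂ : F.map (ε_ x y) ▷ F.obj y = μ F _ _ ≫ F.map (ε_ x y ▷ y) ≫ δ F _ _ := by
      rw [← μ_natural_left_assoc, Functor.Monoidal.μ_δ, comp_id]
    have h₃ : δ F y (x ⊗ y) ≫ F.obj y ◁ δ F x y ≫ (α_ (F.obj y) (F.obj x) (F.obj y)).inv ≫
        μ F y x ▷ F.obj y ≫ μ F _ _ = F.map (α_ y x y).inv := by
      rw [Functor.Monoidal.map_associator_inv]
    simp only [F.map_comp] at h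
    simp only [MonoidalCategory.whiskerLeft_comp, comp_whiskerRight, assoc]
    rw [h₁, h₂]
    simp only [assoc]
    rw [reassoc_of% h₃, reassoc_of% h]
    rw [Functor.Monoidal.map_rightUnitor, Functor.Monoidal.map_leftUnitor_inv]
    simp
  evaluation_coevaluation' := by
    have h := congrArg F.map (ExactPairing.evaluation_coevaluation x y)
    have h₁ : F.map (η_ x y) ▷ F.obj x = μ F _ _ ≫ F.map (η_ x y ▷ x) ≫ δ F _ _ := by
      rw [← μ_natural_left_assoc, Functor.Monoidal.μ_δ, comp_id]
    have h₂ : F.obj x ◁ F.map (ε_ x y) = μ F _ _ ≫ F.map (x ◁ ε_ x y) ≫ δ F _ _ := by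
      rw [← μ_natural_right_assoc, Functor.Monoidal.μ_δ, comp_id]
    have h₃ : δ F (x ⊗ y) x ≫ δ F x y ▷ F.obj x ≫ (α_ (F.obj x) (F.obj y) (F.obj x)).hom ≫
        F.obj x ◁ μ F y x ≫ μ F _ _ = F.map (α_ x y x).hom := by
      rw [Functor.Monoidal.map_associator]
    simp only [F.map_comp] at h
    simp only [MonoidalCategory.whiskerLeft_comp, comp_whiskerRight, assoc]
    rw [h₁, h₂]
    simp only [assoc]
    rw [reassoc_of% h₃, reassoc_of% h]
    rw [Functor.Monoidal.map_leftUnitor, Functor.Monoidal.map_rightUnitor_inv]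
    simp

end Functors

section Compact

variable {C : Type u₁} [Category.{v} C] [Preadditive C] [HasZeroObject C] [HasShift C ℤ]
  [∀ n : ℤ, (shiftFunctor C n).Additive] [Pretriangulated C]
  [MonoidalCategory C] [SymmetricCategory C] [MonoidalClosed C]
  {D : Type u₂} [Category.{v} D] [Preadditive D] [HasZeroObject D] [HasShift D ℤ]
  [∀ n : ℤ, (shiftFunctor D n).Additive] [Pretriangulated D]
  [MonoidalCategory D] [SymmetricCategory D] [MonoidalClosed D]

namespace IsRigidlyCompactlyGenerated

lemma compactObjects_of_exactPairing (hC : IsRigidlyCompactlyGenerated C) (d c : C)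
    [ExactPairing d c] : compactObjects C c :=
  (hC.compact_iff_rigid c).2 (isRigid_of_exactPairing d c)

lemma compactObjects_unit (hC : IsRigidlyCompactlyGenerated C) : compactObjects C (𝟙_ C) :=
  hC.compactObjects_of_exactPairing (𝟙_ C) (𝟙_ C)

/-- Compact objects have compact duals. -/
lemma exists_dual (hC : IsRigidlyCompactlyGenerated C) {c : C} (hc : compactObjects C c) :
    ∃ d : C, compactObjects C d ∧ Nonempty (ExactPairing d c) ∧ Nonempty (ExactPairing c d) := by
  obtain ⟨h, _⟩ := ((hC.compact_iff_rigid c).1 hc).exists_exactPairing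
  let h' : ExactPairing c ((ihom c).obj (𝟙_ C)) := BraidedCategory.exactPairing_swap _ _
  exact ⟨_, hC.compactObjects_of_exactPairing c _, ⟨h⟩, ⟨h'⟩⟩

lemma compactObjects_tensor (hC : IsRigidlyCompactlyGenerated C) {c c' : C}
    (hc : compactObjects C c) (hc' : compactObjects C c') : compactObjects C (c ⊗ c') := by
  obtain ⟨d, _, ⟨_⟩, _⟩ := hC.exists_dual hc
  obtain ⟨d', _, ⟨_⟩, _⟩ := hC.exists_dual hc'
  exact hC.compactObjects_of_exactPairing (d' ⊗ d) (c ⊗ c')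

lemma compactObjects_map (hC : IsRigidlyCompactlyGenerated C)
    (hD : IsRigidlyCompactlyGenerated D) (F : D ⥤ C) [F.Monoidal] {c : D}
    (hc : compactObjects D c) : compactObjects C (F.obj c) := by
  obtain ⟨d, _, ⟨_⟩, _⟩ := hD.exists_dual hc
  let := exactPairingMap F d c
  exact hC.compactObjects_of_exactPairing (F.obj d) (F.obj c)

end IsRigidlyCompactlyGenerated

end Compact

end TensorTriangular

namespace TensorTriangular

/-! ### The projection map, and its invertibility on dualizable objects. -/

section Counit

variable {C : Type u₁} [Category.{v} C] {B : Type u₂} [Category.{v} B]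
  {p : B ⥤ C} {g : C ⥤ B} (adj : p ⊣ g)

/-- The counit `p^* p_* x ⟶ x`. -/
def counitHom (x : C) : p.obj (g.obj x) ⟶ x := adj.counit.app x

lemma counitHom_naturality {x y : C} (k : x ⟶ y) :
    p.map (g.map k) ≫ counitHom adj y = counitHom adj x ≫ k :=
  adj.counit_naturality k

lemma homEquiv_symm_eq {a : B} {x : C} (k : a ⟶ g.obj x) :
    (adj.homEquiv a x).symm k = p.map k ≫ counitHom adj x :=
  adj.homEquiv_counit _ _ _

lemma map_homEquiv_counitHom {a : B} {x : C} (k : p.obj a ⟶ x) :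
    p.map (adj.homEquiv a x k) ≫ counitHom adj x = k := by
  rw [← homEquiv_symm_eq, Equiv.symm_apply_apply]

lemma hom_ext_of_counitHom {a : B} {x : C} {k l : a ⟶ g.obj x}
    (h : p.map k ≫ counitHom adj x = p.map l ≫ counitHom adj x) : k = l := by
  apply (adj.homEquiv _ _).symm.injective
  rwa [homEquiv_symm_eq, homEquiv_symm_eq]

end Counit

section Projection

variable {C : Type u₁} [Category.{v} C] [MonoidalCategory C]
  {B : Type u₂} [Category.{v} B] [MonoidalCategory B]
  {p : B ⥤ C} [p.Monoidal] {g : C ⥤ B} (adj : p ⊣ g)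

open Functor.LaxMonoidal Functor.OplaxMonoidal

/-- The canonical map `p_* x ⊗ b ⟶ p_* (x ⊗ p^* b)` of the projection formula. -/
def projectionMap (x : C) (b : B) : g.obj x ⊗ b ⟶ g.obj (x ⊗ p.obj b) :=
  adj.homEquiv _ _ (δ p (g.obj x) b ≫ counitHom adj x ▷ p.obj b)

lemma map_projectionMap_counitHom (x : C) (b : B) :
    p.map (projectionMap adj x b) ≫ counitHom adj _ =
      δ p (g.obj x) b ≫ counitHom adj x ▷ p.obj b :=
  map_homEquiv_counitHom adj _

lemma projectionMap_naturality_left {x x' : C} (k : x ⟶ x') (b : B) :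
    g.map k ▷ b ≫ projectionMap adj x' b = projectionMap adj x b ≫ g.map (k ▷ p.obj b) := by
  apply hom_ext_of_counitHom adj
  simp only [p.map_comp, assoc, map_projectionMap_counitHom, counitHom_naturality,
    reassoc_of% map_projectionMap_counitHom]
  rw [← δ_natural_left_assoc, ← comp_whiskerRight, counitHom_naturality, comp_whiskerRight]

lemma projectionMap_naturality_right (x : C) {b b' : B} (k : b ⟶ b') :
    g.obj x ◁ k ≫ projectionMap adj x b' = projectionMap adj x b ≫ g.map (x ◁ p.map k) := by
  apply hom_ext_of_counitHom adj
  simp only [p.map_comp, assoc, map_projectionMap_counitHom, counitHom_naturality,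
    reassoc_of% map_projectionMap_counitHom]
  rw [← δ_natural_right_assoc, whisker_exchange]

lemma map_μ_counitHom (x y : C) :
    letI := adj.rightAdjointLaxMonoidal
    p.map (μ g x y) ≫ counitHom adj _ = δ p _ _ ≫ (counitHom adj x ⊗ₘ counitHom adj y) :=
  map_homEquiv_counitHom adj _

/-- Both sides have the same transpose. This brings the projection formula into the duality
comparison, which is defined through the lax structure. -/
lemma whiskerLeft_comp_μ {x y : C} {b : B} (k : b ⟶ g.obj y) :
    letI := adj.rightAdjointLaxMonoidal
    g.obj x ◁ k ≫ μ g x y =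
      projectionMap adj x b ≫ g.map (x ◁ (adj.homEquiv _ _).symm k) := by
  apply hom_ext_of_counitHom adj
  simp only [p.map_comp, assoc, counitHom_naturality, reassoc_of% map_projectionMap_counitHom,
    map_μ_counitHom]
  rw [homEquiv_symm_eq, ← δ_natural_right_assoc, MonoidalCategory.tensorHom_def,
    whisker_exchange_assoc, MonoidalCategory.whiskerLeft_comp]

lemma coevaluation_projectionMap (x : C) (d b : B) [ExactPairing d b] :
    letI := exactPairingMap p d b
    (ρ_ (g.obj x)).inv ≫ g.obj x ◁ η_ d b ≫ (α_ _ _ _).inv ≫ projectionMap adj x d ▷ b ≫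
      projectionMap adj (x ⊗ p.obj d) b =
    g.map ((ρ_ x).inv ≫ x ◁ η_ (p.obj d) (p.obj b) ≫ (α_ _ _ _).inv) := by
  apply hom_ext_of_counitHom adj
  simp only [p.map_comp, assoc, counitHom_naturality, map_projectionMap_counitHom]
  rw [← δ_natural_left_assoc, ← comp_whiskerRight, map_projectionMap_counitHom, comp_whiskerRight]
  have h : p.map ((ρ_ (g.obj x)).inv) ≫ p.map (g.obj x ◁ η_ d b) ≫ p.map (α_ _ _ _).inv ≫
      δ p _ _ ≫ δ p _ _ ▷ p.obj b = (ρ_ _).inv ≫ p.obj (g.obj x) ◁ (ε p ≫ p.map (η_ d b) ≫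
        δ p _ _) ≫ (α_ _ _ _).inv := by
    rw [Functor.Monoidal.map_rightUnitor_inv, Functor.Monoidal.map_associator_inv,
      Functor.Monoidal.map_whiskerLeft]
    simp
  rw [reassoc_of% h]
  change _ = counitHom adj x ≫ (ρ_ x).inv ≫ x ◁ (ε p ≫ p.map (η_ d b) ≫ δ p _ _) ≫ _
  rw [← associator_inv_naturality_left, whisker_exchange_assoc, ← rightUnitor_inv_naturality_assoc]

/-- Maps a ⟶ p_*x ⊗ b are maps a ⊗ d ⟶ p_*x, hence p^*a ⊗ p^*d ⟶ x, hence a ⟶ p_*(x ⊗ p^*b).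
Composition with the projection map realizes this chain, so Yoneda applies. -/
lemma isIso_projectionMap (x : C) (d b : B) [ExactPairing d b] :
    IsIso (projectionMap adj x b) := by
  let := exactPairingMap p d b
  rw [isIso_iff_yoneda_map_bijective]
  intro a
  let E : (a ⟶ g.obj x ⊗ b) ≃ (a ⟶ g.obj (x ⊗ p.obj b)) :=
    (tensorRightHomEquiv a d b (g.obj x)).symm.trans <|
      (adj.homEquiv _ _).symm.trans <|
      ((Functor.Monoidal.μIso p a d).symm.homCongr (Iso.refl x)).trans <|
      (tensorRightHomEquiv (p.obj a) (p.obj d) (p.obj b) x).trans <| adj.homEquiv _ _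
  have : (fun k : a ⟶ g.obj x ⊗ b => k ≫ projectionMap adj x b) = E := by
    ext k
    apply (adj.homEquiv _ _).symm.injective
    apply (tensorRightHomEquiv (p.obj a) (p.obj d) (p.obj b) x).symm.injective
    simp only [E, Equiv.trans_apply, Equiv.symm_apply_apply]
    rw [homEquiv_symm_eq, homEquiv_symm_eq, p.map_comp, assoc, map_projectionMap_counitHom]
    simp only [Iso.homCongr_apply, tensorRightHomEquiv, Equiv.coe_fn_symm_mk]
    have h : μ p _ _ ≫ p.map (α_ (g.obj x) b d).hom ≫ p.map (g.obj x ◁ ε_ d b) ≫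
        p.map (ρ_ (g.obj x)).hom = δ p _ _ ▷ p.obj d ≫ (α_ _ _ _).hom ≫
          p.obj (g.obj x) ◁ (μ p _ _ ≫ p.map (ε_ d b) ≫ η p) ≫ (ρ_ _).hom := by
      rw [Functor.Monoidal.map_rightUnitor, Functor.Monoidal.map_associator,
        Functor.Monoidal.map_whiskerLeft]
      simp [← Functor.LaxMonoidal.associativity_assoc, ← comp_whiskerRight_assoc]
    have h' : p.map (k ▷ d) = δ p _ _ ≫ p.map k ▷ p.obj d ≫ μ p _ _ :=
      Functor.Monoidal.map_whiskerRight p k d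
    simp only [p.map_comp, assoc]
    rw [h']
    change _ = μ p a d ≫ _ ≫ _
    simp only [assoc, Functor.Monoidal.μ_δ_assoc, reassoc_of% h, Iso.refl_hom, comp_id,
      comp_whiskerRight, ← rightUnitor_naturality]
    rw [associator_naturality_left_assoc, whisker_exchange_assoc]
    rfl
  rw [this]
  exact E.bijective

end Projection

end TensorTriangular

namespace TensorTriangular

/-! ### The projection formula and the formula for p^(1) on arbitrary objects. -/

section ClosedTriangulated

variable {C : Type u₁} [Category.{v} C] [Preadditive C] [HasZeroObject C] [HasShift C ℤ]
  [∀ n : ℤ, (shiftFunctor C n).Additive] [Pretriangulated C]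
  [MonoidalCategory C] [SymmetricCategory C] [MonoidalClosed C] [TensorTriangulated C]

lemma isHomological_tensorLeft_comp (y : C) (H : C ⥤ AddCommGrpCat.{v}) [H.IsHomological] :
    (tensorLeft y ⋙ H).IsHomological := by
  have : (tensorLeft y).PreservesZeroMorphisms := inferInstance
  have : (tensorRight y).PreservesZeroMorphisms :=
    Functor.preservesZeroMorphisms_of_iso (BraidedCategory.tensorLeftIsoTensorRight y)
  have : (tensorRight y ⋙ H).IsHomological :=
    ⟨fun T hT => H.map_distinguished_exact _ (TensorTriangulated.tensor_exact T hT y)⟩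
  exact Functor.IsHomological.of_iso
    (Functor.isoWhiskerRight (BraidedCategory.tensorLeftIsoTensorRight y).symm H)

end ClosedTriangulated

lemma PreservesCoproducts.comp {C : Type u₁} [Category.{v} C] {D : Type u₂} [Category.{v} D]
    {E : Type u₃} [Category.{v} E] {F : D ⥤ C} {G : C ⥤ E} (hF : PreservesCoproducts F)
    (hG : PreservesCoproducts G) : PreservesCoproducts (F ⋙ G) := fun J => by
  have := hF J
  have := hG J
  infer_instance

lemma preservesCoproducts_tensorLeft {C : Type u₁} [Category.{v} C] [MonoidalCategory C]
    [MonoidalClosed C] (x : C) : PreservesCoproducts (tensorLeft x) := fun _ => inferInstance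

section RightAdjoint

variable {C : Type u₁} [Category.{v} C] [Preadditive C] [HasZeroObject C] [HasShift C ℤ]
  [∀ n : ℤ, (shiftFunctor C n).Additive] [Pretriangulated C]
  {B : Type u₂} [Category.{v} B] [Preadditive B] [HasZeroObject B] [HasShift B ℤ]
  [∀ n : ℤ, (shiftFunctor B n).Additive] [Pretriangulated B]
  {p : B ⥤ C} {g : C ⥤ B} (adj : p ⊣ g)

include adj in
/-- The right adjoint of a functor which preserves compact objects preserves coproducts. -/
lemma preservesCoproducts_rightAdjoint [p.Additive] (hB : IsCompactlyGeneratedCategory B)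
    (hC : HasCoproducts.{v} C)
    (h : ∀ b, compactObjects B b → compactObjects C (p.obj b)) : PreservesCoproducts g := by
  have := hB.hasCoproducts
  have : g.Additive := adj.right_adjoint_additive
  intro J
  apply +allowSynthFailures preservesColimitsOfShape_of_discrete
  intro x
  apply +allowSynthFailures PreservesCoproduct.of_iso_comparison
  refine hB.isIso _ fun b hb => ⟨?_, ?_⟩
  -- Injectivity: the projections of the coproduct factor through the comparison map, and they
  -- detect maps from the compact object b.
  · have hπ (j) : sigmaComparison g x ≫ g.map (coproductProjection x j) =
        coproductProjection (fun j => g.obj (x j)) j := by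
      ext i
      rw [ι_comp_sigmaComparison_assoc, ← g.map_comp]
      by_cases hij : i = j
      · subst hij
        simp
      · rw [ι_coproductProjection_of_ne _ hij, ι_coproductProjection_of_ne _ hij, g.map_zero]
    intro k l hkl
    have hkl' : k ≫ sigmaComparison g x = l ≫ sigmaComparison g x := hkl
    rw [← sub_eq_zero]
    obtain ⟨S, hS⟩ := hb.factorsFinitely _ (k - l)
    rw [← hS, finiteProjection_eq_sum, Preadditive.comp_sum]
    refine Finset.sum_eq_zero fun j _ => ?_
    rw [← hπ, assoc, Preadditive.sub_comp, reassoc_of% hkl', sub_self]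
  · intro φ
    -- Surjectivity: the transpose of φ starts at the compact object p^*b, so only finitely many
    -- components of φ are needed to build a preimage.
    obtain ⟨S, hS⟩ := (h b hb).factorsFinitely _ ((adj.homEquiv _ _).symm φ)
    refine ⟨∑ j ∈ S, φ ≫ g.map (coproductProjection x j) ≫ Sigma.ι (fun j => g.obj (x j)) j, ?_⟩
    change _ ≫ sigmaComparison g x = φ
    rw [Preadditive.sum_comp]
    simp only [assoc, ι_comp_sigmaComparison]
    rw [← Preadditive.comp_sum]
    simp only [← g.map_comp]
    rw [← g.map_sum, ← finiteProjection_eq_sum]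
    apply (adj.homEquiv _ _).symm.injective
    rw [adj.homEquiv_naturality_right_symm]
    exact hS

end RightAdjoint

section Formulas

variable {C : Type u₁} [Category.{v} C] [Preadditive C] [HasZeroObject C] [HasShift C ℤ]
  [∀ n : ℤ, (shiftFunctor C n).Additive] [Pretriangulated C]
  [MonoidalCategory C] [SymmetricCategory C] [MonoidalClosed C] [TensorTriangulated C]
  {B : Type u₂} [Category.{v} B] [Preadditive B] [HasZeroObject B] [HasShift B ℤ]
  [∀ n : ℤ, (shiftFunctor B n).Additive] [Pretriangulated B]
  [MonoidalCategory B] [SymmetricCategory B] [MonoidalClosed B] [TensorTriangulated B]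
  (hB : IsRigidlyCompactlyGenerated B) (hC : IsRigidlyCompactlyGenerated C)
  {p : B ⥤ C} [p.Monoidal] [p.CommShift ℤ] [p.IsTriangulated] (hp : PreservesCoproducts p)
  {g : C ⥤ B} (adj : p ⊣ g)

include hB hC adj in
lemma preservesCoproducts_push : PreservesCoproducts g :=
  preservesCoproducts_rightAdjoint adj hB.toIsCompactlyGeneratedCategory hC.hasCoproducts
    fun _ hb => hC.compactObjects_map hB p hb

include adj in
lemma isHomological_push_comp (H : B ⥤ AddCommGrpCat.{v}) [H.IsHomological] :
    (g ⋙ H).IsHomological := by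
  let := adj.rightAdjointCommShift ℤ
  have := adj.commShift_of_leftAdjoint ℤ
  have := adj.isTriangulated_rightAdjoint
  infer_instance

include hB hC hp in
/-- The projection formula. -/
lemma isIso_projectionMap_of_preservesCoproducts (x : C) (b : B) :
    IsIso (projectionMap adj x b) := by
  refine hB.isIso _ fun a ha => ?_
  let K := preadditiveCoyoneda.obj (op a)
  let η : tensorLeft (g.obj x) ⋙ K ⟶ p ⋙ tensorLeft x ⋙ g ⋙ K :=
    Functor.whiskerRight (G := tensorLeft (g.obj x)) (H := p ⋙ tensorLeft x ⋙ g)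
      { app := fun b => projectionMap adj x b
        naturality := fun _ _ k => projectionMap_naturality_right adj x k } K
  have hη (b : B) (h : IsIso (projectionMap adj x b)) : IsIso (η.app b) :=
    inferInstanceAs (IsIso (K.map (projectionMap adj x b)))
  have := isHomological_tensorLeft_comp (g.obj x) K
  have := isHomological_push_comp adj K
  have := isHomological_tensorLeft_comp x (g ⋙ K)
  have : IsIso (η.app b) := hB.isIso_app η
    ((preservesCoproducts_tensorLeft _).comp ha)
    (hp.comp ((preservesCoproducts_tensorLeft _).comp
      ((preservesCoproducts_push hB hC adj).comp ha)))
    (fun c hc => by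
      obtain ⟨d, _, ⟨_⟩, _⟩ := hB.exists_dual hc
      exact hη _ (isIso_projectionMap adj x d c)) b
  rw [ConcreteCategory.isIso_iff_bijective] at this
  exact this

section Twist

variable {t : B ⥤ C} (adj' : g ⊣ t)

/-- The canonical map `p^(1) 𝟙 ⊗ p^* b ⟶ p^(1) b`, given the projection formula. -/
noncomputable def twistMap (h : ∀ x b, IsIso (projectionMap adj x b)) (b : B) :
    t.obj (𝟙_ B) ⊗ p.obj b ⟶ t.obj b :=
  adj'.homEquiv _ _ (inv (projectionMap adj (t.obj (𝟙_ B)) b) ≫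
    counitHom adj' (𝟙_ B) ▷ b ≫ (λ_ b).hom)

lemma twistMap_naturality (h : ∀ x b, IsIso (projectionMap adj x b)) {b b' : B} (k : b ⟶ b') :
    t.obj (𝟙_ B) ◁ p.map k ≫ twistMap adj adj' h b' = twistMap adj adj' h b ≫ t.map k := by
  rw [twistMap, twistMap, ← adj'.homEquiv_naturality_left, ← adj'.homEquiv_naturality_right]
  congr 1
  rw [← cancel_epi (projectionMap adj (t.obj (𝟙_ B)) b),
    ← reassoc_of% projectionMap_naturality_right]
  simp only [assoc, IsIso.hom_inv_id_assoc]
  rw [whisker_exchange_assoc, leftUnitor_naturality]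

/-- With ω = p^(1)𝟙, maps a ⟶ ω ⊗ p^*b are maps a ⊗ p^*d ⟶ ω, hence p_*a ⊗ d ≅ p_*(a ⊗ p^*d) ⟶ 𝟙,
hence p_*a ⟶ b, hence a ⟶ p^(1)b. -/
lemma isIso_twistMap (h : ∀ x b, IsIso (projectionMap adj x b)) (d b : B) [ExactPairing d b] :
    IsIso (twistMap adj adj' h b) := by
  let := exactPairingMap p d b
  rw [isIso_iff_yoneda_map_bijective]
  intro a
  let ω := t.obj (𝟙_ B)
  let E : (a ⟶ ω ⊗ p.obj b) ≃ (a ⟶ t.obj b) :=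
    (tensorRightHomEquiv a (p.obj d) (p.obj b) ω).symm.trans <|
      (adj'.homEquiv _ _).symm.trans <|
      ((asIso (projectionMap adj a d)).symm.homCongr (Iso.refl (𝟙_ B))).trans <|
      (tensorRightHomEquiv (g.obj a) d b (𝟙_ B)).trans <|
      ((Iso.refl (g.obj a)).homCongr (λ_ b)).trans <| adj'.homEquiv _ _
  have : (fun k : a ⟶ ω ⊗ p.obj b => k ≫ twistMap adj adj' h b) = E := by
    ext k
    obtain ⟨k, rfl⟩ := (tensorRightHomEquiv a (p.obj d) (p.obj b) ω).surjective k
    apply (adj'.homEquiv _ _).symm.injective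
    simp only [E, Equiv.trans_apply, Equiv.symm_apply_apply]
    rw [adj'.homEquiv_naturality_left_symm, twistMap, Equiv.symm_apply_apply, homEquiv_symm_eq]
    -- The inverse projection map is eliminated here: on maps built from the coevaluation of (d, b)
    -- it can be written with the projection map for d.
    have h₁ : g.map (tensorRightHomEquiv a (p.obj d) (p.obj b) ω k) ≫
        inv (projectionMap adj ω b) = (ρ_ (g.obj a)).inv ≫ g.obj a ◁ η_ d b ≫ (α_ _ _ _).inv ≫
          projectionMap adj a d ▷ b ≫ g.map k ▷ b := by
      rw [← cancel_mono (projectionMap adj ω b)]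
      simp only [assoc, IsIso.inv_hom_id, comp_id, projectionMap_naturality_left]
      have := coevaluation_projectionMap adj a d b =≫ g.map (k ▷ p.obj b)
      simp only [assoc] at this
      rw [this, ← g.map_comp]
      simp [tensorRightHomEquiv]
    rw [reassoc_of% h₁]
    simp [Iso.homCongr_apply, tensorRightHomEquiv]
  rw [this]
  exact E.bijective

include hB hC hp adj adj' in
/-- The relative dualizing object determines `p^(1)` if `p_*` preserves compact objects. -/
lemma nonempty_twist_iso (hg : ∀ c, compactObjects C c → compactObjects B (g.obj c)) (b : B) :
    Nonempty (t.obj (𝟙_ B) ⊗ p.obj b ≅ t.obj b) := by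
  have h := isIso_projectionMap_of_preservesCoproducts hB hC hp adj
  suffices IsIso (twistMap adj adj' h b) from ⟨asIso (twistMap adj adj' h b)⟩
  refine hC.isIso _ fun a ha => ?_
  let K := preadditiveCoyoneda.obj (op a)
  let η : p ⋙ tensorLeft (t.obj (𝟙_ B)) ⋙ K ⟶ t ⋙ K :=
    Functor.whiskerRight (G := p ⋙ tensorLeft (t.obj (𝟙_ B))) (H := t)
      { app := fun b => twistMap adj adj' h b
        naturality := fun _ _ k => twistMap_naturality adj adj' h k } K
  have hη (b : B) (h : IsIso (twistMap adj adj' h b)) : IsIso (η.app b) :=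
    inferInstanceAs (IsIso (K.map (twistMap adj adj' _ b)))
  have : g.Additive := by
    let := adj.rightAdjointCommShift ℤ
    have := adj.commShift_of_leftAdjoint ℤ
    have := adj.isTriangulated_rightAdjoint
    infer_instance
  -- Hom(a, p^(1)y) ≅ Hom(p_*a, y) preserves coproducts in y because p_*a is compact.
  let e : preadditiveCoyoneda.obj (op (g.obj a)) ≅ t ⋙ K :=
    NatIso.ofComponents (fun y => AddEquiv.toAddCommGrpIso (adj'.homAddEquiv a y))
      (fun {y y'} k => by
        ext φ
        exact adj'.homEquiv_naturality_right φ k)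
  have := isHomological_tensorLeft_comp (t.obj (𝟙_ B)) K
  have : (t ⋙ K).IsHomological := Functor.IsHomological.of_iso e
  have : IsIso (η.app b) := hB.isIso_app η
    (hp.comp ((preservesCoproducts_tensorLeft _).comp ha))
    (fun J => by
      have := hg a ha J
      exact preservesColimitsOfShape_of_natIso e)
    (fun c hc => by
      obtain ⟨d, _, ⟨_⟩, _⟩ := hB.exists_dual hc
      exact hη _ (isIso_twistMap adj adj' h d c)) b
  rw [ConcreteCategory.isIso_iff_bijective] at this
  exact this

end Twist

end Formulas

end TensorTriangular

namespace TensorTriangular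

/-! ### Dualities, and the comparison p_*[x, γ] ⟶ [p_*x, δ]. -/

section GeneralDuality

variable {A : Type u₁} [Category.{v} A] (𝒜 : Duality A)

/-- The dual functor of a category with duality is right adjoint to its opposite. -/
def Duality.adjunction : 𝒜.dual.rightOp ⊣ 𝒜.dual where
  unit := 𝒜.bidual
  counit :=
    { app := fun x => (𝒜.bidual.app x.unop).op
      naturality := fun _ _ k => congrArg Quiver.Hom.op (𝒜.bidual.naturality k.unop).symm }
  left_triangle_components := fun x => congrArg Quiver.Hom.op (𝒜.bidual_dual x)
  right_triangle_components := fun x => 𝒜.bidual_dual x.unop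

/-- The dual functor is adjoint to its own opposite, with unit and counit both given by biduality.
-/
lemma Duality.isEquivalence_dual_iff :
    𝒜.dual.IsEquivalence ↔ ∀ x, IsIso (𝒜.bidual.app x) := by
  constructor
  · intro _ x
    have : IsIso (𝒜.adjunction.counit.app (op x)) := inferInstance
    exact (isIso_op_iff _).1 this
  · intro h
    have (x : A) : IsIso (𝒜.adjunction.unit.app x) := h x
    have (x : Aᵒᵖ) : IsIso (𝒜.adjunction.counit.app x) := (isIso_op_iff _).2 (h x.unop)
    exact 𝒜.adjunction.toEquivalence.isEquivalence_inverse

end GeneralDuality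

section Comparison

open Functor.LaxMonoidal Functor.OplaxMonoidal

variable {C : Type u₁} [Category.{v} C] [MonoidalCategory C] [SymmetricCategory C]
  {D : Type u₂} [Category.{v} D] [MonoidalCategory D] [SymmetricCategory D]
  {f : D ⥤ C} [f.Braided]

lemma μ_map_braiding {g : C ⥤ D} (adj : f ⊣ g) (x y : C) :
    letI := adj.rightAdjointLaxMonoidal
    μ g x y ≫ g.map (β_ x y).hom = (β_ _ _).hom ≫ μ g y x := by
  apply hom_ext_of_counitHom adj
  rw [f.map_comp, f.map_comp, assoc, assoc, counitHom_naturality, map_μ_counitHom,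
    reassoc_of% map_μ_counitHom adj x y, Functor.map_braiding, BraidedCategory.braiding_naturality]
  simp

variable [MonoidalClosed C] [MonoidalClosed D] (A : AdjointTriple f) {γ : C} {δ : D}
  (ψ : γ ⟶ A.twist.obj δ)

/-- `AdjointTriple.dualComparison`, stated in terms of internal homs. -/
def ihomComparison (x : C) :
    A.push.obj ((ihom x).obj γ) ⟶ (ihom (A.push.obj x)).obj δ :=
  A.dualComparison ψ x

lemma uncurry_ihomComparison (x : C) :
    letI := A.adj₁.rightAdjointLaxMonoidal
    A.push.obj x ◁ ihomComparison A ψ x ≫ (ihom.ev (A.push.obj x)).app δ =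
      μ A.push x ((ihom x).obj γ) ≫ A.push.map ((ihom.ev x).app γ) ≫
        (A.adj₂.homEquiv γ δ).symm ψ := by
  rw [← MonoidalClosed.uncurry_eq]
  exact MonoidalClosed.uncurry_curry _

lemma uncurry_comp_ihomComparison (x : C) {b : D} (k : b ⟶ A.push.obj ((ihom x).obj γ)) :
    MonoidalClosed.uncurry (k ≫ ihomComparison A ψ x) =
      projectionMap A.adj₁ x b ≫
        (A.adj₂.homEquiv _ _).symm
          (MonoidalClosed.uncurry ((A.adj₁.homEquiv _ _).symm k) ≫ ψ) := by
  rw [MonoidalClosed.uncurry_natural_left, MonoidalClosed.uncurry_eq, uncurry_ihomComparison,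
    reassoc_of% whiskerLeft_comp_μ A.adj₁ k,
    A.adj₂.homEquiv_naturality_left_symm, MonoidalClosed.uncurry_eq, A.push.map_comp, assoc]

/-- Maps b ⟶ f_*[x, γ] are maps x ⊗ f^*b ⟶ γ ≅ f^(1)δ, hence f_*x ⊗ b ≅ f_*(x ⊗ f^*b) ⟶ δ, hence b ⟶
[f_*x, δ]. No compactness of f_* enters. -/
lemma isIso_ihomComparison [IsIso ψ] (x : C) (h : ∀ b, IsIso (projectionMap A.adj₁ x b)) :
    IsIso (ihomComparison A ψ x) := by
  rw [isIso_iff_yoneda_map_bijective]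
  intro b
  let E : (b ⟶ A.push.obj ((ihom x).obj γ)) ≃ (b ⟶ (ihom (A.push.obj x)).obj δ) :=
    (A.adj₁.homEquiv _ _).symm.trans <|
      ((ihom.adjunction x).homEquiv _ _).symm.trans <|
      ((Iso.refl _).homCongr (asIso ψ)).trans <|
      (A.adj₂.homEquiv _ _).symm.trans <|
      ((asIso (projectionMap A.adj₁ x b)).symm.homCongr (Iso.refl δ)).trans <|
      (ihom.adjunction (A.push.obj x)).homEquiv _ _
  have : (fun k => k ≫ ihomComparison A ψ x) = E := by
    ext k
    apply MonoidalClosed.uncurry_injective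
    refine (uncurry_comp_ihomComparison A ψ x k).trans ?_
    change _ = ((ihom.adjunction (A.push.obj x)).homEquiv _ _).symm _
    simp only [E, Equiv.trans_apply, Equiv.symm_apply_apply, Iso.homCongr_apply, Iso.refl_inv,
      Iso.refl_hom, id_comp, comp_id, asIso_hom, Iso.symm_inv]
    rfl
  rw [this]
  exact E.bijective

lemma ihomComparison_naturality {x y : C} (k : x ⟶ y) :
    A.push.map ((MonoidalClosed.pre k).app γ) ≫ ihomComparison A ψ x =
      ihomComparison A ψ y ≫ (MonoidalClosed.pre (A.push.map k)).app δ := by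
  let := A.adj₁.rightAdjointLaxMonoidal
  apply MonoidalClosed.uncurry_injective
  rw [MonoidalClosed.uncurry_eq, MonoidalClosed.uncurry_eq, MonoidalCategory.whiskerLeft_comp,
    MonoidalCategory.whiskerLeft_comp, assoc, assoc, uncurry_ihomComparison,
    MonoidalClosed.id_tensor_pre_app_comp_ev, whisker_exchange_assoc, uncurry_ihomComparison,
    μ_natural_right_assoc, μ_natural_left_assoc, ← A.push.map_comp_assoc,
    ← A.push.map_comp_assoc, MonoidalClosed.id_tensor_pre_app_comp_ev]

/-- After uncurrying, each side is evaluation preceded by a symmetry, taken before or after the lax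
structure of f_*; the two agree since f_* is lax symmetric (`μ_map_braiding`). -/
lemma map_biduality_ihomComparison (x : C) :
    A.push.map (biduality γ x) ≫ ihomComparison A ψ ((ihom x).obj γ) =
      biduality δ (A.push.obj x) ≫ (MonoidalClosed.pre (ihomComparison A ψ x)).app δ := by
  let := A.adj₁.rightAdjointLaxMonoidal
  apply MonoidalClosed.uncurry_injective
  rw [MonoidalClosed.uncurry_eq, MonoidalClosed.uncurry_eq, MonoidalCategory.whiskerLeft_comp,
    MonoidalCategory.whiskerLeft_comp, assoc, assoc, uncurry_ihomComparison,
    MonoidalClosed.id_tensor_pre_app_comp_ev, whisker_exchange_assoc, ← MonoidalClosed.uncurry_eq,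
    biduality, biduality, MonoidalClosed.uncurry_curry,
    BraidedCategory.braiding_naturality_left_assoc, uncurry_ihomComparison,
    μ_natural_right_assoc, ← reassoc_of% μ_map_braiding A.adj₁, ← A.push.map_comp_assoc,
    ← A.push.map_comp_assoc, ← MonoidalClosed.uncurry_eq, MonoidalClosed.uncurry_curry]

end Comparison

end TensorTriangular

namespace TensorTriangular

/-! ### Compact pull-backs of submodules. -/

section ShiftTensor

variable {C : Type u₁} [Category.{v} C] [Preadditive C] [HasZeroObject C] [HasShift C ℤ]
  [∀ n : ℤ, (shiftFunctor C n).Additive] [Pretriangulated C]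
  [MonoidalCategory C] [SymmetricCategory C] [MonoidalClosed C] [TensorTriangulated C]

/-- Iterating the given isomorphism for n = 1 handles n ≥ 0; for negative n one descends along the
fully faithful suspension. -/
lemma nonempty_shift_tensor_iso (n : ℤ) : ∀ x y : C, Nonempty (x⟦n⟧ ⊗ y ≅ (x ⊗ y)⟦n⟧) := by
  induction n with
  | zero =>
    intro x y
    exact ⟨whiskerRightIso ((shiftFunctorZero C ℤ).app x) y ≪≫
      ((shiftFunctorZero C ℤ).app (x ⊗ y)).symm⟩
  | succ n hn =>
    intro x y
    obtain ⟨i⟩ := hn x y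
    exact ⟨whiskerRightIso ((shiftFunctorAdd C (n : ℤ) 1).app x) y ≪≫
      TensorTriangulated.e _ _ ≪≫ (shiftFunctor C (1 : ℤ)).mapIso i ≪≫
      ((shiftFunctorAdd C (n : ℤ) 1).app (x ⊗ y)).symm⟩
  | pred n hn =>
    intro x y
    obtain ⟨i⟩ := hn x y
    let s (z : C) : z⟦(-n : ℤ)⟧ ≅ (z⟦(-n - 1 : ℤ)⟧)⟦(1 : ℤ)⟧ :=
      (shiftFunctorAdd' C (-n - 1 : ℤ) 1 (-n) (by lia)).app z
    exact ⟨(shiftFunctor C (1 : ℤ)).preimageIso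
      ((TensorTriangulated.e _ _).symm ≪≫ whiskerRightIso (s x).symm y ≪≫ i ≪≫ s (x ⊗ y))⟩

end ShiftTensor

section CompactPullback

variable {C : Type u₁} [Category.{v} C] [Preadditive C] [HasZeroObject C] [HasShift C ℤ]
  [∀ n : ℤ, (shiftFunctor C n).Additive] [Pretriangulated C]
  [MonoidalCategory C] [SymmetricCategory C] [MonoidalClosed C] [TensorTriangulated C]
  {B : Type u₂} [Category.{v} B] [Preadditive B] [HasZeroObject B] [HasShift B ℤ]
  [∀ n : ℤ, (shiftFunctor B n).Additive] [Pretriangulated B]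
  [MonoidalCategory B] [SymmetricCategory B] [MonoidalClosed B]
  (hC : IsRigidlyCompactlyGenerated C)

lemma isStableUnderRetracts_compactPullback (g : C ⥤ B) (B₀ : ObjectProperty B)
    [B₀.IsStableUnderRetracts] : (compactPullback g B₀).IsStableUnderRetracts where
  of_retract r h c hc := B₀.prop_of_retract (r.map (tensorLeft c ⋙ g)) (h c hc)

include hC in
/-- Compact pull-backs of submodules are submodules. -/
lemma isCompactSubmodule_compactPullback {p : B ⥤ C} [p.CommShift ℤ] [p.IsTriangulated]
    {g : C ⥤ B} (adj : p ⊣ g) {B₀ : ObjectProperty B} [B₀.IsTriangulated]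
    [B₀.IsStableUnderRetracts] : IsCompactSubmodule (compactPullback g B₀) where
  isTriangulated := by
    let := adj.rightAdjointCommShift ℤ
    have := adj.commShift_of_leftAdjoint ℤ
    have := adj.isTriangulated_rightAdjoint
    have := isStableUnderRetracts_compactPullback g B₀
    have hg {x y : C} (i : x ≅ y) : B₀ (g.obj x) → B₀ (g.obj y) := B₀.prop_of_iso (g.mapIso i)
    exact
      { exists_zero := ⟨_, isZero_zero C, fun c _ => B₀.prop_of_isZero
          (g.map_isZero ((tensorLeft c).map_isZero (isZero_zero C)))⟩
        isStableUnderShiftBy := fun n => ⟨fun x hx c hc => by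
          obtain ⟨i⟩ := nonempty_shift_tensor_iso n x c
          refine B₀.prop_of_iso ?_ (B₀.le_shift n _ (hx c hc))
          exact (g.commShiftIso n).symm.app (c ⊗ x) ≪≫
            g.mapIso ((shiftFunctor C n).mapIso (β_ c x) ≪≫ i.symm ≪≫ β_ _ _)⟩
        toIsTriangulatedClosed₂ := .mk' fun T hT h₁ h₃ c hc => by
          refine hg (β_ T.obj₂ c) ?_
          exact B₀.ext_of_isTriangulatedClosed₂ _
            (g.map_distinguished _ (TensorTriangulated.tensor_exact T hT c))
            (hg (β_ c T.obj₁) (h₁ c hc)) (hg (β_ c T.obj₃) (h₃ c hc)) }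
  isStableUnderRetracts := isStableUnderRetracts_compactPullback g B₀
  tensor_mem c x hc hx c' hc' := B₀.prop_of_iso (g.mapIso (α_ c' c x))
    (hx (c' ⊗ c) (hC.compactObjects_tensor hc' hc))

include hC in
lemma obj_mem_of_compactPullback {g : C ⥤ B} {B₀ : ObjectProperty B}
    [B₀.IsClosedUnderIsomorphisms] {x : C} (hx : compactPullback g B₀ x) : B₀ (g.obj x) :=
  B₀.prop_of_iso (g.mapIso (λ_ x)) (hx _ hC.compactObjects_unit)

variable {D : Type u₃} [Category.{v} D] [Preadditive D] [HasZeroObject D] [HasShift D ℤ]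
  [∀ n : ℤ, (shiftFunctor D n).Additive] [Pretriangulated D]
  [MonoidalCategory D] [SymmetricCategory D] [MonoidalClosed D]
  (hD : IsRigidlyCompactlyGenerated D)

include hC hD in
/-- Compact pull-back is compatible with composition. -/
lemma compactPullback_compactPullback {p : B ⥤ C} {q : B ⥤ D} {f : D ⥤ C} [f.Monoidal]
    (α : q ⋙ f ≅ p) {p' : C ⥤ B} {q' : D ⥤ B} {f' : C ⥤ D} (adj_p : p ⊣ p') (adj_q : q ⊣ q')
    (adj_f : f ⊣ f') (B₀ : ObjectProperty B) [B₀.IsClosedUnderIsomorphisms] :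
    compactPullback f' (compactPullback q' B₀) = compactPullback p' B₀ := by
  let i : f' ⋙ q' ≅ p' := ((adj_q.comp adj_f).ofNatIsoLeft α).rightAdjointUniq adj_p
  ext x
  refine ⟨fun h c hc => ?_, fun h c hc d hd => ?_⟩
  · exact B₀.prop_of_iso (q'.mapIso (λ_ _) ≪≫ i.app (c ⊗ x)) (h c hc _ hD.compactObjects_unit)
  · obtain ⟨e, _, ⟨_⟩, _⟩ := hD.exists_dual hd
    have := isIso_projectionMap adj_f (c ⊗ x) e d
    -- For dualizable d the projection formula turns q_*(d ⊗ f_*(c ⊗ x)) into p_*((f^*d ⊗ c) ⊗ x),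
    -- so f^*d ⊗ c is the compact test object. The converse inclusion uses d = 𝟙.
    refine B₀.prop_of_iso ?_ (h (f.obj d ⊗ c)
      (hC.compactObjects_tensor (hC.compactObjects_map hD f hd) hc))
    exact (i.app _).symm ≪≫ q'.mapIso (f'.mapIso (α_ _ _ _ ≪≫ β_ _ _) ≪≫
      (asIso (projectionMap adj_f (c ⊗ x) d)).symm ≪≫ β_ _ _)

end CompactPullback

end TensorTriangular

namespace TensorTriangular

/-! ### Reflexivity tested on dualizable objects. -/

section InternalHom

variable {C : Type u₁} [Category.{v} C] [MonoidalCategory C] [MonoidalClosed C]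

/-- The canonical map `c ⊗ [x, γ] ⟶ [x ⊗ d, γ]` for a dual pair `(c, d)`. -/
def tensorIhomMap (γ x c d : C) [ExactPairing c d] :
    c ⊗ (ihom x).obj γ ⟶ (ihom (x ⊗ d)).obj γ :=
  MonoidalClosed.curry ((α_ x d _).hom ≫ x ◁ ((α_ d c _).inv ≫ ε_ c d ▷ _ ≫ (λ_ _).hom) ≫
    (ihom.ev x).app γ)

lemma uncurry_tensorIhomMap (γ x c d : C) [ExactPairing c d] :
    (x ⊗ d) ◁ tensorIhomMap γ x c d ≫ (ihom.ev (x ⊗ d)).app γ =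
      (α_ x d _).hom ≫ x ◁ ((α_ d c _).inv ≫ ε_ c d ▷ _ ≫ (λ_ _).hom) ≫ (ihom.ev x).app γ := by
  rw [← MonoidalClosed.uncurry_eq]
  exact MonoidalClosed.uncurry_curry _

instance (γ x c d : C) [ExactPairing c d] : IsIso (tensorIhomMap γ x c d) := by
  rw [isIso_iff_yoneda_map_bijective]
  intro a
  let E : (a ⟶ c ⊗ (ihom x).obj γ) ≃ (a ⟶ (ihom (x ⊗ d)).obj γ) :=
    (tensorLeftHomEquiv a c d _).symm.trans <|
      ((ihom.adjunction x).homEquiv _ _).symm.trans <|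
      ((α_ x d a).symm.homCongr (Iso.refl γ)).trans <| (ihom.adjunction (x ⊗ d)).homEquiv _ _
  have : (fun k => k ≫ tensorIhomMap γ x c d) = E := by
    ext k
    apply MonoidalClosed.uncurry_injective
    trans (α_ x d a).hom ≫ MonoidalClosed.uncurry ((tensorLeftHomEquiv a c d _).symm k)
    · rw [MonoidalClosed.uncurry_natural_left, MonoidalClosed.uncurry_eq, uncurry_tensorIhomMap,
        associator_naturality_right_assoc, MonoidalClosed.uncurry_eq,
        ← MonoidalCategory.whiskerLeft_comp_assoc]
      rfl
    · refine Eq.trans ?_ (Equiv.symm_apply_apply ((ihom.adjunction (x ⊗ d)).homEquiv _ _) _).symm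
      simp [Iso.homCongr_apply]
      rfl
  rw [this]
  exact E.bijective

variable [SymmetricCategory C]

/-- Uncurrying and swapping factors removes the double dual, leaving a pairing with [x, γ]. -/
lemma bijective_comp_biduality_iff (γ x a : C) :
    (Function.Bijective fun k : a ⟶ x => k ≫ biduality γ x) ↔
      Function.Bijective fun k : a ⟶ x => k ▷ (ihom x).obj γ ≫ (ihom.ev x).app γ := by
  let E : (a ⟶ (ihom ((ihom x).obj γ)).obj γ) ≃ (a ⊗ (ihom x).obj γ ⟶ γ) :=
    ((ihom.adjunction _).homEquiv a γ).symm.trans ((β_ _ _).symm.homCongr (Iso.refl γ))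
  rw [← E.bijective.of_comp_iff' ]
  refine iff_of_eq (congrArg Function.Bijective (funext fun k => ?_))
  trans (β_ a _).hom ≫ MonoidalClosed.uncurry (k ≫ biduality γ x) ≫ 𝟙 γ
  · rfl
  rw [MonoidalClosed.uncurry_natural_left, biduality, MonoidalClosed.uncurry_curry, comp_id,
    ← BraidedCategory.braiding_naturality_left_assoc, SymmetricCategory.symmetry_assoc]

-- Sliding k past the evaluation leaves a zigzag for (c, d), which is the identity.
omit [MonoidalClosed C] [SymmetricCategory C] in
lemma coevaluation_whiskerRight_comp (c d : C) [ExactPairing c d] {x y γ : C} (k : c ⟶ x)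
    (l : x ⊗ y ⟶ γ) :
    (η_ c d ≫ k ▷ d) ▷ (c ⊗ y) ≫ (α_ x d _).hom ≫
        x ◁ ((α_ d c _).inv ≫ ε_ c d ▷ _ ≫ (λ_ _).hom) ≫ l =
      (λ_ (c ⊗ y)).hom ≫ k ▷ y ≫ l := by
  calc _ = 𝟙 _ ⊗≫ (η_ c d ▷ c) ▷ y ⊗≫ (k ▷ ((d ⊗ c) ⊗ y) ≫ x ◁ (ε_ c d ▷ y)) ⊗≫ l := by monoidal
    _ = 𝟙 _ ⊗≫ (η_ c d ▷ c) ▷ y ⊗≫ (c ◁ (ε_ c d ▷ y) ≫ k ▷ (𝟙_ C ⊗ y)) ⊗≫ l := by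
      rw [whisker_exchange]
    _ = (λ_ (c ⊗ y)).hom ≫ (λ_ c).inv ▷ y ≫
        (η_ c d ▷ c ≫ (α_ _ _ _).hom ≫ c ◁ ε_ c d) ▷ y ≫
        (ρ_ c).hom ▷ y ≫ k ▷ y ≫ l := by monoidal
    _ = _ := by
      rw [ExactPairing.evaluation_coevaluation]
      monoidal

lemma coevaluation_comp_tensorIhomMap (γ x c d : C) [ExactPairing c d] (k : c ⟶ x) :
    𝟙_ C ◁ tensorIhomMap γ x c d ≫ (η_ c d ≫ k ▷ d) ▷ _ ≫ (ihom.ev (x ⊗ d)).app γ =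
      (λ_ _).hom ≫ k ▷ _ ≫ (ihom.ev x).app γ := by
  rw [whisker_exchange_assoc, uncurry_tensorIhomMap]
  exact coevaluation_whiskerRight_comp c d k ((ihom.ev x).app γ)

/-- Reduction of reflexivity, tested on an object with a dual, to the unit. -/
lemma bijective_comp_biduality_of_exactPairing (γ x c d : C) [ExactPairing c d]
    (h : Function.Bijective fun k : 𝟙_ C ⟶ x ⊗ d => k ≫ biduality γ (x ⊗ d)) :
    Function.Bijective fun k : c ⟶ x => k ≫ biduality γ x := by
  rw [bijective_comp_biduality_iff] at h ⊢
  let E₁ : (c ⟶ x) ≃ (𝟙_ C ⟶ x ⊗ d) :=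
    ((λ_ c).symm.homCongr (Iso.refl x)).trans (tensorRightHomEquiv (𝟙_ C) c d x)
  let E₂ : (𝟙_ C ⊗ (ihom (x ⊗ d)).obj γ ⟶ γ) ≃ (c ⊗ (ihom x).obj γ ⟶ γ) :=
    ((whiskerLeftIso (𝟙_ C) (asIso (tensorIhomMap γ x c d)).symm ≪≫ λ_ _).homCongr (Iso.refl γ))
  have hE (k : c ⟶ x) : E₁ k = η_ c d ≫ k ▷ d := by
    simp [E₁, tensorRightHomEquiv, Iso.homCongr_apply]
    monoidal
  have := (E₂.bijective.comp h).comp E₁.bijective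
  refine (congrArg Function.Bijective (funext fun k => ?_)).mp this
  trans E₂ ((η_ c d ≫ k ▷ d) ▷ _ ≫ (ihom.ev (x ⊗ d)).app γ)
  · rw [← hE]
    rfl
  trans ((λ_ _).inv ≫ 𝟙_ C ◁ tensorIhomMap γ x c d) ≫
    (η_ c d ≫ k ▷ d) ▷ _ ≫ (ihom.ev (x ⊗ d)).app γ
  · exact congrArg _ (comp_id _)
  rw [assoc, coevaluation_comp_tensorIhomMap, Iso.inv_hom_id_assoc]

/-- Rigid objects are reflexive. -/
lemma IsRigid.isIso_biduality {x : C} (hx : IsRigid x) : IsIso (biduality (𝟙_ C) x) := by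
  obtain ⟨e, he⟩ := hx.exists_exactPairing
  rw [isIso_iff_yoneda_map_bijective]
  intro a
  rw [bijective_comp_biduality_iff]
  let E : (a ⟶ x) ≃ (a ⊗ (ihom x).obj (𝟙_ C) ⟶ 𝟙_ C) :=
    ((Iso.refl a).homCongr (λ_ x).symm).trans (tensorRightHomEquiv a _ x (𝟙_ C)).symm
  refine (congrArg Function.Bijective (funext fun k => ?_)).mp E.bijective
  have he' : ε_ ((ihom x).obj (𝟙_ C)) x = (ihom.ev x).app (𝟙_ C) := he
  simp [E, tensorRightHomEquiv, he']
  monoidal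

end InternalHom

/-! ### Dualizing objects in terms of reflexivity, and the unit as an example. -/

section Dualizing

variable {C : Type u₁} [Category.{v} C] [Preadditive C] [HasZeroObject C] [HasShift C ℤ]
  [∀ n : ℤ, (shiftFunctor C n).Additive] [Pretriangulated C]
  [MonoidalCategory C] [SymmetricCategory C] [MonoidalClosed C]

lemma IsDualizingObject.isIso_biduality {C₀ : ObjectProperty C} {κ : C}
    (h : IsDualizingObject C₀ κ) {x : C} (hx : C₀ x) : IsIso (biduality κ x) :=
  (ObjectProperty.isIso_hom_iff _).2
    ((Duality.isEquivalence_dual_iff h.duality).1 h.isEquivalence ⟨x, hx⟩)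

lemma IsDualizingObject.of_isIso_biduality {C₀ : ObjectProperty C} {κ : C}
    (h : IsCompactSubmodule C₀) (mem : C₀ κ) (dual_mem : ∀ x, C₀ x → C₀ ((ihom x).obj κ))
    (isIso : ∀ x, C₀ x → IsIso (biduality κ x)) : IsDualizingObject C₀ κ where
  isCompactSubmodule := h
  mem := mem
  dual_mem := dual_mem
  isEquivalence := (Duality.isEquivalence_dual_iff ((twistedDuality κ).restrict C₀ dual_mem)).2
    fun x => (ObjectProperty.isIso_hom_iff _).1 (isIso x.obj x.property)

variable (hC : IsRigidlyCompactlyGenerated C)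

-- Here d is the dual of c. The isomorphism shows that κ-twisted duals of compact objects stay in
-- any submodule containing κ.
include hC in
lemma IsRigidlyCompactlyGenerated.exists_ihom_iso {c : C} (hc : compactObjects C c) :
    ∃ d : C, compactObjects C d ∧ ∀ κ, Nonempty (d ⊗ κ ≅ (ihom c).obj κ) := by
  obtain ⟨d, hd, ⟨_⟩, _⟩ := hC.exists_dual hc
  exact ⟨d, hd, fun κ => ⟨whiskerLeftIso d ((MonoidalClosed.unitNatIso).app κ) ≪≫
    asIso (tensorIhomMap κ (𝟙_ C) d c) ≪≫
    (MonoidalClosed.internalHom.mapIso (λ_ c).symm.op).app κ⟩⟩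

include hC in
/-- The unit is a dualizing object for the compact objects. -/
lemma isDualizingObject_unit : IsDualizingObject (compactObjects C) (𝟙_ C) := by
  have := hC.hasCoproducts
  refine .of_isIso_biduality ⟨isTriangulated_compactObjects, isStableUnderRetracts_compactObjects,
    fun _ _ => hC.compactObjects_tensor⟩ hC.compactObjects_unit (fun x hx => ?_)
    (fun x hx => ((hC.compact_iff_rigid x).1 hx).isIso_biduality)
  obtain ⟨d, hd, h⟩ := hC.exists_ihom_iso hx
  exact (compactObjects C).prop_of_iso (h (𝟙_ C)).some
    (hC.compactObjects_tensor hd hC.compactObjects_unit)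

end Dualizing

end TensorTriangular

/-! ### Pulling back dualizing objects, and the duality-preserving push-forward. -/

namespace TensorTriangular

/-- By adjunction, maps out of p^*b only see the image of k under p_*. This replaces conservativity
of p_*. -/
lemma bijective_comp_of_isIso_map {C : Type u₁} [Category.{v} C] {B : Type u₂} [Category.{v} B]
    {p : B ⥤ C} {g : C ⥤ B} (adj : p ⊣ g) {x y : C} (k : x ⟶ y) [IsIso (g.map k)] {a : C} {b : B}
    (e : a ≅ p.obj b) : Function.Bijective fun l : a ⟶ x => l ≫ k := by
  let E : (a ⟶ x) ≃ (a ⟶ y) := (e.homCongr (Iso.refl x)).trans <| (adj.homEquiv b x).trans <|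
    ((Iso.refl b).homCongr (asIso (g.map k))).trans <| (adj.homEquiv b y).symm.trans <|
    e.symm.homCongr (Iso.refl y)
  refine (congrArg Function.Bijective (funext fun l => ?_)).mp E.bijective
  simp [E, Iso.homCongr_apply, adj.homEquiv_naturality_right_symm]

section AdjointTriple

variable {C : Type u₁} [Category.{v} C] [Preadditive C] [HasZeroObject C] [HasShift C ℤ]
  [∀ n : ℤ, (shiftFunctor C n).Additive] [Pretriangulated C]
  [MonoidalCategory C] [SymmetricCategory C] [MonoidalClosed C] [TensorTriangulated C]
  {B : Type u₂} [Category.{v} B] [Preadditive B] [HasZeroObject B] [HasShift B ℤ]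
  [∀ n : ℤ, (shiftFunctor B n).Additive] [Pretriangulated B]
  [MonoidalCategory B] [SymmetricCategory B] [MonoidalClosed B] [TensorTriangulated B]
  (hB : IsRigidlyCompactlyGenerated B) (hC : IsRigidlyCompactlyGenerated C)
  {p : B ⥤ C} [p.Braided] [p.CommShift ℤ] [p.IsTriangulated] (hp : PreservesCoproducts p)

include hB hC hp

lemma nonempty_adjointTriple [IsTriangulated B] [IsTriangulated C] :
    Nonempty (AdjointTriple p) := by
  obtain ⟨g, ⟨adj⟩⟩ := hB.toIsCompactlyGeneratedCategory.exists_rightAdjoint hp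
  let := adj.rightAdjointCommShift ℤ
  have := adj.commShift_of_leftAdjoint ℤ
  have := adj.isTriangulated_rightAdjoint
  obtain ⟨t, ⟨adj'⟩⟩ := hC.toIsCompactlyGeneratedCategory.exists_rightAdjoint
    (preservesCoproducts_push hB hC adj)
  exact ⟨⟨g, t, adj, adj'⟩⟩

variable (A : AdjointTriple p)

/-- Compatibility of the invertible comparison maps with biduality expresses p_*(ϖ_γ) through ϖ_κ at
p_*x. -/
lemma isIso_push_map_biduality {κ : B} {γ : C} (ψ : γ ≅ A.twist.obj κ) (x : C)
    [IsIso (biduality κ (A.push.obj x))] : IsIso (A.push.map (biduality γ x)) := by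
  have h := isIso_projectionMap_of_preservesCoproducts hB hC hp A.adj₁
  have (y : C) := isIso_ihomComparison A ψ.hom y (h y)
  have : IsIso ((MonoidalClosed.pre (ihomComparison A ψ.hom x)).app κ) :=
    inferInstanceAs (IsIso ((MonoidalClosed.internalHom.map
      (ihomComparison A ψ.hom x).op).app κ))
  have : IsIso (A.push.map (biduality γ x) ≫ ihomComparison A ψ.hom ((ihom x).obj γ)) := by
    rw [map_biduality_ihomComparison]
    infer_instance
  exact IsIso.of_isIso_comp_right _ (ihomComparison A ψ.hom ((ihom x).obj γ))

/-- Dualizing objects pull back along `p^*` to dualizing objects under Grothendieck–Neeman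
duality. -/
lemma isDualizingObject_compactPullback
    (hg : ∀ c, compactObjects C c → compactObjects B (A.push.obj c))
    {B₀ : ObjectProperty B} {κ : B} (hκ : IsDualizingObject B₀ κ) {γ : C}
    (ψ : γ ≅ A.twist.obj κ) : IsDualizingObject (compactPullback A.push B₀) γ := by
  have := hκ.isCompactSubmodule.isTriangulated
  have := hκ.isCompactSubmodule.isStableUnderRetracts
  have hsub := isCompactSubmodule_compactPullback hC A.adj₁ (B₀ := B₀)
  have := hsub.isStableUnderRetracts
  -- This rests on p_*(c ⊗ [x, γ]) ≅ p_*[x ⊗ d, γ] ≅ [p_*(x ⊗ d), κ].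
  have hdual (x c d : C) [ExactPairing c d] (h : B₀ ((ihom (A.push.obj (x ⊗ d))).obj κ)) :
      B₀ (A.push.obj (c ⊗ (ihom x).obj γ)) := by
    have := isIso_ihomComparison A ψ.hom (x ⊗ d)
      (isIso_projectionMap_of_preservesCoproducts hB hC hp A.adj₁ _)
    exact B₀.prop_of_iso ((asIso (ihomComparison A ψ.hom (x ⊗ d))).symm ≪≫
      A.push.mapIso (asIso (tensorIhomMap γ x c d)).symm) h
  refine .of_isIso_biduality hsub (fun c hc => ?_) (fun x hx c hc => ?_) (fun x hx => ?_)
  · obtain ⟨d, hd, _, ⟨_⟩⟩ := hC.exists_dual hc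
    refine B₀.prop_of_iso (A.push.mapIso
      (whiskerLeftIso c ((MonoidalClosed.unitNatIso).app γ).symm)) (hdual (𝟙_ C) c d ?_)
    -- Membership of γ ≅ [𝟙, γ] is the only place where p_* must preserve compact objects: it makes
    -- [p_*(𝟙 ⊗ d), κ] of the form e ⊗ κ with e compact.
    obtain ⟨e, he, i⟩ := hB.exists_ihom_iso
      (hg _ (hC.compactObjects_tensor hC.compactObjects_unit hd))
    exact B₀.prop_of_iso (i κ).some (hκ.isCompactSubmodule.tensor_mem _ _ he hκ.mem)
  · obtain ⟨d, hd, _, ⟨_⟩⟩ := hC.exists_dual hc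
    exact hdual x c d (hκ.dual_mem _ (B₀.prop_of_iso (A.push.mapIso (β_ d x)) (hx d hd)))
  · refine hC.isIso _ fun c hc => ?_
    obtain ⟨d, hd, _, ⟨_⟩⟩ := hC.exists_dual hc
    -- Passing from c ⟶ x to 𝟙 ⟶ x ⊗ d makes the test object p^*𝟙, for which p_* suffices.
    refine bijective_comp_biduality_of_exactPairing γ x c d ?_
    have hy : compactPullback A.push B₀ (x ⊗ d) :=
      ObjectProperty.prop_of_iso _ (β_ d x) (hsub.tensor_mem d x hd hx)
    have := hκ.isIso_biduality (obj_mem_of_compactPullback hC hy)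
    have := isIso_push_map_biduality hB hC hp A ψ (x ⊗ d)
    exact bijective_comp_of_isIso_map A.adj₁ _ (Functor.Monoidal.εIso p)

lemma restrictsToDualityPreserving {C₀ : ObjectProperty C} {B₀ : ObjectProperty B} {γ : C} {δ : B}
    (hγ : IsDualizingObject C₀ γ) (hδ : IsDualizingObject B₀ δ)
    (h : ∀ x, C₀ x → B₀ (A.push.obj x)) (i : Nonempty (γ ≅ A.twist.obj δ)) :
    A.RestrictsToDualityPreserving hγ hδ := by
  refine ⟨h, ?_, i, fun ψ => ?_⟩
  · let := A.adj₁.rightAdjointCommShift ℤ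
    have := A.adj₁.commShift_of_leftAdjoint ℤ
    have := A.adj₁.isTriangulated_rightAdjoint
    have := hγ.isCompactSubmodule.isTriangulated
    have := hδ.isCompactSubmodule.isTriangulated
    infer_instance
  · have (x : C) := isIso_ihomComparison A ψ.hom x
      (isIso_projectionMap_of_preservesCoproducts hB hC hp A.adj₁ x)
    let e (x : C) : A.push.obj ((ihom x).obj γ) ≅ (ihom (A.push.obj x)).obj δ :=
      asIso (ihomComparison A ψ.hom x)
    let ζ : hγ.duality.dual ⋙ A.restrictPush C₀ B₀ h ≅
        (A.restrictPush C₀ B₀ h).op ⋙ hδ.duality.dual :=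
      NatIso.ofComponents
        (fun x => B₀.isoMk (e x.unop.obj))
        (fun {x y} k => by
          ext
          exact ihomComparison_naturality A ψ.hom k.unop.hom)
    refine ⟨⟨ζ, fun x => ?_⟩, fun x => rfl⟩
    ext
    exact map_biduality_ihomComparison A ψ.hom x.obj

omit [TensorTriangulated C] [TensorTriangulated B] [p.Braided] [p.CommShift ℤ]
  [p.IsTriangulated] hB hC hp in
lemma SatisfiesGrothendieckNeeman.compactObjects_push (h : SatisfiesGrothendieckNeeman p) {c : C}
    (hc : compactObjects C c) : compactObjects B (A.push.obj c) := by
  obtain ⟨g, adj, hg⟩ := h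
  exact (compactObjects B).prop_of_iso ((adj.rightAdjointUniq A.adj₁).app c) (hg c hc)

end AdjointTriple

end TensorTriangular

theorem mainTheorem8
    {B : Type u₁} [Category.{v} B] [Preadditive B] [HasZeroObject B] [HasShift B ℤ]
    [∀ n : ℤ, (shiftFunctor B n).Additive] [Pretriangulated B] [IsTriangulated B]
    [MonoidalCategory B] [SymmetricCategory B] [MonoidalClosed B] [TensorTriangulated B]
    {C : Type u₂} [Category.{v} C] [Preadditive C] [HasZeroObject C] [HasShift C ℤ]
    [∀ n : ℤ, (shiftFunctor C n).Additive] [Pretriangulated C] [IsTriangulated C]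
    [MonoidalCategory C] [SymmetricCategory C] [MonoidalClosed C] [TensorTriangulated C]
    {D : Type u₃} [Category.{v} D] [Preadditive D] [HasZeroObject D] [HasShift D ℤ]
    [∀ n : ℤ, (shiftFunctor D n).Additive] [Pretriangulated D] [IsTriangulated D]
    [MonoidalCategory D] [SymmetricCategory D] [MonoidalClosed D] [TensorTriangulated D]
    (hB : IsRigidlyCompactlyGenerated B) (hC : IsRigidlyCompactlyGenerated C)
    (hD : IsRigidlyCompactlyGenerated D)
    (p : B ⥤ C) [p.Braided] [p.CommShift ℤ] [p.IsTriangulated] (hp : PreservesCoproducts p)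
    (q : B ⥤ D) [q.Braided] [q.CommShift ℤ] [q.IsTriangulated] (hq : PreservesCoproducts q)
    (f : D ⥤ C) [f.Braided] [f.CommShift ℤ] [f.IsTriangulated] (hf : PreservesCoproducts f)
    (α : q ⋙ f ≅ p) :
    Nonempty (AdjointTriple p) ∧ Nonempty (AdjointTriple q) ∧ Nonempty (AdjointTriple f) ∧
    ∀ (P : AdjointTriple p) (Q : AdjointTriple q) (F : AdjointTriple f),
      (SatisfiesGrothendieckNeeman p → SatisfiesGrothendieckNeeman q →
        ∀ (B₀ : ObjectProperty B) (κ : B), IsDualizingObject B₀ κ →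
          compactPullback F.push (compactPullback Q.push B₀) = compactPullback P.push B₀ ∧
          ∃ (hγ : IsDualizingObject (compactPullback P.push B₀) (P.ω ⊗ p.obj κ))
            (hδ : IsDualizingObject (compactPullback Q.push B₀) (Q.ω ⊗ q.obj κ)),
            F.RestrictsToDualityPreserving hγ hδ) ∧
      compactPullback F.push (compactPullback Q.push (compactObjects B)) =
        compactPullback P.push (compactObjects B) ∧
      (SatisfiesGrothendieckNeeman p →
        IsDualizingObject (compactPullback P.push (compactObjects B)) P.ω) ∧
      (SatisfiesGrothendieckNeeman p → SatisfiesGrothendieckNeeman q →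
        ∃ (hγ : IsDualizingObject (compactPullback P.push (compactObjects B)) P.ω)
          (hδ : IsDualizingObject (compactPullback Q.push (compactObjects B)) Q.ω),
          F.RestrictsToDualityPreserving hγ hδ) := by
  refine ⟨nonempty_adjointTriple hB hC hp, nonempty_adjointTriple hB hD hq,
    nonempty_adjointTriple hD hC hf, fun P Q F => ?_⟩
  have hP := fun (h : SatisfiesGrothendieckNeeman p) c => h.compactObjects_push P (c := c)
  have hQ := fun (h : SatisfiesGrothendieckNeeman q) c => h.compactObjects_push Q (c := c)
  have hpull (B₀ : ObjectProperty B) [B₀.IsClosedUnderIsomorphisms] :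
      compactPullback F.push (compactPullback Q.push B₀) = compactPullback P.push B₀ :=
    compactPullback_compactPullback hC hD α P.adj₁ Q.adj₁ F.adj₁ B₀
  have hpush (B₀ : ObjectProperty B) (h : IsCompactSubmodule B₀) (x : C)
      (hx : compactPullback P.push B₀ x) : compactPullback Q.push B₀ (F.push.obj x) := by
    have := h.isTriangulated
    have := h.isStableUnderRetracts
    have := isStableUnderRetracts_compactPullback Q.push B₀
    rw [← hpull B₀] at hx
    exact obj_mem_of_compactPullback hC hx
  -- Uniqueness of right adjoints is used twice: p_* ≅ q_* f_*, and then p^(1) ≅ f^(1) q^(1).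
  have htwist (b : B) : Nonempty (P.twist.obj b ≅ F.twist.obj (Q.twist.obj b)) := by
    let e : P.push ≅ F.push ⋙ Q.push :=
      P.adj₁.rightAdjointUniq ((Q.adj₁.comp F.adj₁).ofNatIsoLeft α)
    exact ⟨((P.adj₂.ofNatIsoLeft e).rightAdjointUniq (F.adj₂.comp Q.adj₂)).app b⟩
  have h₁ := isDualizingObject_unit hB
  have h₃ (h : SatisfiesGrothendieckNeeman p) :
      IsDualizingObject (compactPullback P.push (compactObjects B)) P.ω :=
    isDualizingObject_compactPullback hB hC hp P (hP h) h₁ (Iso.refl _)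
  refine ⟨fun hp' hq' B₀ κ hκ => ?_, hpull _, h₃, fun hp' hq' => ?_⟩
  · have := hκ.isCompactSubmodule.isStableUnderRetracts
    -- These isomorphisms replace ω_p ⊗ p^*κ by p^(1)κ and ω_q ⊗ q^*κ by q^(1)κ. For κ = 𝟙 the
    -- objects ω_p and ω_q have that form by definition, so parts 3 and 4 do without them.
    obtain ⟨eP⟩ := nonempty_twist_iso hB hC hp P.adj₁ P.adj₂ (hP hp') κ
    obtain ⟨eQ⟩ := nonempty_twist_iso hB hD hq Q.adj₁ Q.adj₂ (hQ hq') κ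
    obtain ⟨e⟩ := htwist κ
    exact ⟨hpull B₀, isDualizingObject_compactPullback hB hC hp P (hP hp') hκ eP,
      isDualizingObject_compactPullback hB hD hq Q (hQ hq') hκ eQ,
      restrictsToDualityPreserving hD hC hf F _ _ (hpush B₀ hκ.isCompactSubmodule)
        ⟨eP ≪≫ e ≪≫ F.twist.mapIso eQ.symm⟩⟩
  · exact ⟨h₃ hp', isDualizingObject_compactPullback hB hD hq Q (hQ hq') h₁ (Iso.refl _),
      restrictsToDualityPreserving hD hC hf F _ _ (hpush _ h₁.isCompactSubmodule) (htwist (𝟙_ B))⟩
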